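/- Let $E$ be a Euclidean space with scalar product $(\cdot,\cdot)$, $\Phi\subset E$ an irreducible reduced (crystallographic) root system with Weyl group $W$, coroots $\alpha^\vee=2\alpha/\|\alpha\|^2$, base $\{\alpha_1,\dots,\alpha_r\}$, simple reflections $s_i=s_{\alpha_i}$, and weight lattice $P=\{\lambda\in E : (\lambda,\alpha^\vee)\in\mathbb Z\ \forall\alpha\in\Phi\}$. Let $\mathbf Q:P\to\mathbb Q$ be a $W$-invariant quadratic form with integer values on the root lattice $\mathbb Z\Phi$, $\mathbf B(\lambda,\mu)=\mathbf Q(\lambda+\mu)-\mathbf Q(\lambda)-\mathbf Q(\mu)$, let $n$ be a positive integer, and put $m(\alpha)=n/\gcd(n,\mathbf Q(\alpha))$ and $\alpha^m=m(\alpha)\alpha$ for $\alpha\in\Phi$. Let $P^m\subseteq P$ be the weight lattice of the root system $\Phi^m=\{\alpha^m\}_{\alpha\in\Phi}$, i.e. $P^m=\{\lambda\in P : m(\alpha)\mid(\lambda,\alpha^\vee)\ \forall\alpha\in\Phi\}$. For a root $\alpha$ let $\mathrm{size}(\alpha^m)\in\{sh,lg\}$ record whether $\alpha^m$ is a short or a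 long root of $\Phi^m$ (all roots are long if they have the same length). Let $\mathbf k:\Phi\to\mathbb C^\times$ be $W$-invariant, write $\mathbf k_i=\mathbf k_{\alpha_i}$, and let $\mathbf k_y$ be the value of $\mathbf k_\alpha$ for the roots with $\mathrm{size}(\alpha^m)=y$. Let $g_j(y)\in\mathbb C^\times$ ($j\in\mathbb Z$, $y\in\{sh,lg\}$) satisfy: $g_j(y)=-1$ if $n\mid j$; $g_j(y)$ depends only on $j$ modulo $n$; and $g_j(y)g_{n-j}(y)=\mathbf k_y^{-2}$ if $n\nmid j$ (for each $y$ that occurs as a size). The extended affine Hecke algebra $\widetilde H^m(\mathbf k)$ is the unital associative $\mathbb C$-algebra generated by $T_1,\dots,T_r$ and the group algebra $\mathbb C[P^m]=\mathrm{span}\{x^\nu\}_{\nu\in P^m}$ with defining relations $(T_i-\mathbf k_i)(T_i+\mathbf k_i^{-1})=0$; the braid relations $T_iT_jT_i\cdots=T_jT_iT_j\cdots$ ($i\neq j$, with as many factors on each side as the order of $s_is_j$); and $$T_ix^\nu-x^{s_i\nu}T_i=(\mathbf k_i-\mathbf k_i^{-1})\,\frac{x^\nu-x^{s_i\nu}}{1-x^{\alpha_i^m}}\qquad(\nu\in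 P^m).$$ For $\lambda\in P$ let $\overline\lambda$ be its class in $P/P^m$, and set $$\overline\nabla_i(x^\lambda)=\frac{x^\lambda-x^{s_i\lambda+r_i(\lambda)\alpha_i}}{1-x^{\alpha_i^m}},\qquad \mathbf p_i(\overline\lambda)=-\mathbf k_i\,g_{-\mathbf B(\lambda,\alpha_i)}(\mathrm{size}(\alpha_i^m)),$$ where $r_i(\lambda)\in\{0,\dots,m(\alpha_i)-1\}$ is the remainder of $(\lambda,\alpha_i^\vee)$ modulo $m(\alpha_i)$ (the quotient lies in $\mathbb C[P]$, and $\mathbf p_i$ is well defined on $P/P^m$). Theorem. The formulas $$\pi(T_i)x^\lambda=(\mathbf k_i-\mathbf k_i^{-1})\overline\nabla_i(x^\lambda)+\mathbf p_i(\overline\lambda)\,x^{s_i\lambda},\qquad \pi(x^\nu)x^\lambda=x^{\lambda+\nu}$$ for $\lambda\in P$, $i=1,\dots,r$ and $\nu\in P^m$ turn $\mathbb C[P]=\mathrm{span}\{x^\lambda\}_{\lambda\in P}$ into a left $\widetilde H^m(\mathbf k)$-module: there is exactly one algebra homomorphism $\pi:\widetilde H^m(\mathbf k)\to\mathrm{End}_{\mathbb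 C}(\mathbb C[P])$ given by these formulas. -/

import Mathlib

namespace Metaplectic

noncomputable section

/-! ### Group algebras and geometric quotients -/

/-- The basis element `x^a` of the group algebra `ℂ[G]` of an additive group `G`. -/
def mon {G : Type*} (a : G) : AddMonoidAlgebra ℂ G := AddMonoidAlgebra.single a 1

/-- The linear map on `ℂ[G]` with prescribed values `x^a ↦ f a` on the basis. -/
def linExt {G V : Type*} [AddCommGroup V] [Module ℂ V] (f : G → V) :
    AddMonoidAlgebra ℂ G →ₗ[ℂ] V :=
  (Finsupp.linearCombination ℂ f).comp (AddMonoidAlgebra.coeffLinearEquiv ℂ).toLinearMap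

theorem linExt_mon {G V : Type*} [AddCommGroup V] [Module ℂ V] (f : G → V) (a : G) :
    linExt f (mon a) = f a := by
  simp [linExt, mon]

theorem mon_mul {G : Type*} [AddCommGroup G] (a b : G) :
    mon a * mon b = mon (a + b) := by
  simp [mon, AddMonoidAlgebra.single_mul_single]

theorem mon_zero {G : Type*} [AddCommGroup G] : mon (0 : G) = 1 := rfl

/-- The element `(1 - x^(-N β)) / (1 - x^β)` of the group algebra `ℂ[G]`, written as
`1 + x^β + ⋯ + x^((-N-1) β)` for `N < 0` and as `-(x^(-β) + ⋯ + x^(-N β))` for `N > 0`. -/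
def geomQuot {G : Type*} [AddCommGroup G] (β : G) (N : ℤ) : AddMonoidAlgebra ℂ G :=
  (∑ j ∈ Finset.range (-N).toNat, mon (j • β)) -
    ∑ j ∈ Finset.range N.toNat, mon (-((j + 1) • β))

/-- `geomQuot β N` is indeed the quotient of `1 - x^(-N β)` by `1 - x^β`. -/
theorem one_sub_mul_geomQuot {G : Type*} [AddCommGroup G] (β : G) (N : ℤ) :
    (1 - mon β) * geomQuot β N = 1 - mon (-(N • β)) := by
  have h1 : ∀ n : ℕ, (1 - mon β) * (∑ j ∈ Finset.range n, mon (j • β)) = 1 - mon (n • β) := by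
    intro n
    induction n with
    | zero => simp [mon_zero]
    | succ n ih =>
      rw [Finset.sum_range_succ, mul_add, ih, sub_mul, one_mul, mon_mul, succ_nsmul, add_comm β]
      abel
  have h2 : ∀ n : ℕ, (1 - mon β) * (∑ j ∈ Finset.range n, mon (-((j + 1) • β)))
      = mon (-(n • β)) - 1 := by
    intro n
    induction n with
    | zero => simp [mon_zero]
    | succ n ih =>
      have e : β + -((n + 1) • β) = -(n • β) := by rw [succ_nsmul]; abel
      rw [Finset.sum_range_succ, mul_add, ih, sub_mul, one_mul, mon_mul, e]
      abel
  rw [geomQuot, mul_sub, h1, h2]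
  rcases le_total 0 N with h | h
  · obtain ⟨n, rfl⟩ := Int.eq_ofNat_of_zero_le h
    simp [mon_zero]
  · obtain ⟨n, hn⟩ := Int.eq_ofNat_of_zero_le (Int.neg_nonneg_of_nonpos h)
    obtain rfl : N = -(n : ℤ) := by omega
    simp [mon_zero]

/-- The alternating product `a b a ⋯` with `n` factors. -/
def altProd {A : Type*} [Monoid A] (a b : A) : ℕ → A
  | 0 => 1
  | n + 1 => a * altProd b a n

/-! ### Root systems in Euclidean spaces -/

section Roots

variable {ι E : Type*} [NormedAddCommGroup E] [InnerProductSpace ℝ E]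

/-- The root pairing is that of a root system in the Euclidean space `E`: the pairing is
the scalar product and the coroot of `α` is `2 α / ‖α‖²`. -/
structure IsEuclidean (Φ : RootPairing ι ℝ E E) : Prop where
  pairing_eq : ∀ x y : E, Φ.toLinearMap x y = inner ℝ x y
  coroot_eq : ∀ i : ι, Φ.coroot i = (2 / ‖Φ.root i‖ ^ 2) • Φ.root i

/-- The weight lattice `P = {x ∈ E | (x, α^∨) ∈ ℤ for all roots α}`. -/
def weightLattice (Φ : RootPairing ι ℝ E E) : AddSubgroup E where
  carrier := {x | ∀ i, ∃ z : ℤ, Φ.toLinearMap x (Φ.coroot i) = z}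
  zero_mem' i := ⟨0, by simp⟩
  add_mem' {x y} hx hy i := by
    obtain ⟨a, ha⟩ := hx i
    obtain ⟨b, hb⟩ := hy i
    exact ⟨a + b, by simp [ha, hb]⟩
  neg_mem' {x} hx i := by
    obtain ⟨a, ha⟩ := hx i
    exact ⟨-a, by simp [ha]⟩

/-- The integer `(x, α^∨)` for a weight `x` and a root `α`. -/
def pair {Φ : RootPairing ι ℝ E E} (x : weightLattice Φ) (i : ι) : ℤ := (x.2 i).choose

theorem cast_pair {Φ : RootPairing ι ℝ E E} (x : weightLattice Φ) (i : ι) :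
    (pair x i : ℝ) = Φ.toLinearMap x (Φ.coroot i) := (x.2 i).choose_spec.symm

theorem pair_add {Φ : RootPairing ι ℝ E E} (x y : weightLattice Φ) (i : ι) :
    pair (x + y) i = pair x i + pair y i := by
  have : (pair (x + y) i : ℝ) = pair x i + pair y i := by simp [cast_pair]
  exact_mod_cast this

theorem pair_neg {Φ : RootPairing ι ℝ E E} (x : weightLattice Φ) (i : ι) :
    pair (-x) i = -pair x i := by
  have : (pair (-x) i : ℝ) = -pair x i := by simp [cast_pair]
  exact_mod_cast this

theorem pair_zero {Φ : RootPairing ι ℝ E E} (i : ι) :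
    pair (0 : weightLattice Φ) i = 0 := by
  have : (pair (0 : weightLattice Φ) i : ℝ) = 0 := by simp [cast_pair]
  exact_mod_cast this

theorem pair_zsmul {Φ : RootPairing ι ℝ E E} (c : ℤ) (x : weightLattice Φ) (i : ι) :
    pair (c • x) i = c * pair x i := by
  have : (pair (c • x) i : ℝ) = c * pair x i := by
    simp [cast_pair]
  exact_mod_cast this

/-- A root, as an element of the weight lattice. -/
def rootP (Φ : RootPairing ι ℝ E E) [Φ.IsCrystallographic] (i : ι) : weightLattice Φ :=
  ⟨Φ.root i, fun j => by
    obtain ⟨z, hz⟩ := Φ.exists_value (S := ℤ) i j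
    exact ⟨z, by simpa using hz.symm⟩⟩

/-- The root lattice `ℤΦ`, as a subgroup of the weight lattice. -/
def rootLattice (Φ : RootPairing ι ℝ E E) [Φ.IsCrystallographic] :
    AddSubgroup (weightLattice Φ) :=
  AddSubgroup.closure (Set.range (rootP Φ))

/-- The reflection `s_α x = x - (x, α^∨) α` on the weight lattice. -/
def refl {Φ : RootPairing ι ℝ E E} [Φ.IsCrystallographic] (i : ι) (x : weightLattice Φ) :
    weightLattice Φ :=
  x - pair x i • rootP Φ i

theorem coe_refl {Φ : RootPairing ι ℝ E E} [Φ.IsCrystallographic] (i : ι)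
    (x : weightLattice Φ) : (refl i x : E) = Φ.reflection i x := by
  have h : ((pair x i • rootP Φ i : weightLattice Φ) : E) = (pair x i : ℝ) • Φ.root i := by
    rw [AddSubgroup.coe_zsmul, Int.cast_smul_eq_zsmul]
    rfl
  rw [refl, AddSubgroup.coe_sub, h, cast_pair, RootPairing.reflection_apply]
  rfl

theorem pair_root_self {Φ : RootPairing ι ℝ E E} [Φ.IsCrystallographic] (i : ι) :
    pair (rootP Φ i) i = 2 := by
  have : (pair (rootP Φ i) i : ℝ) = 2 := by
    rw [cast_pair]; exact Φ.root_coroot_two i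
  exact_mod_cast this

theorem pair_refl {Φ : RootPairing ι ℝ E E} [Φ.IsCrystallographic] (i j : ι)
    (x : weightLattice Φ) : pair (refl i x) j = pair x (Φ.reflectionPerm i j) := by
  have : (pair (refl i x) j : ℝ) = pair x (Φ.reflectionPerm i j) := by
    rw [cast_pair, cast_pair, coe_refl, RootPairing.coroot_reflectionPerm,
      RootPairing.reflection_apply, RootPairing.coreflection_apply]
    simp
    ring
  exact_mod_cast this

/-! ### The metaplectic structure -/

/-- Metaplectic data on a root system: a Weyl group invariant quadratic form `Q : P → ℚ`,
integral on the root lattice, and a positive integer `n`. (Invariance is required for all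
reflections, which generate the Weyl group.) -/
structure Datum (Φ : RootPairing ι ℝ E E) [Φ.IsCrystallographic] where
  Q : QuadraticMap ℤ (weightLattice Φ) ℚ
  Q_refl : ∀ (i : ι) (x : weightLattice Φ), Q (refl i x) = Q x
  Q_integral : ∀ x ∈ rootLattice Φ, ∃ z : ℤ, Q x = z
  n : ℕ
  n_pos : 0 < n

namespace Datum

variable {Φ : RootPairing ι ℝ E E} [Φ.IsCrystallographic] (D : Datum Φ)

/-- The bilinear form `B(x, y) = Q(x + y) - Q(x) - Q(y)`. -/
def B (x y : weightLattice Φ) : ℚ := D.Q (x + y) - D.Q x - D.Q y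

/-- The integer `Q(α)`. -/
def QRoot (i : ι) : ℤ := ⌊D.Q (rootP Φ i)⌋

theorem cast_QRoot (i : ι) : (D.QRoot i : ℚ) = D.Q (rootP Φ i) := by
  obtain ⟨z, hz⟩ := D.Q_integral _ (AddSubgroup.subset_closure ⟨i, rfl⟩)
  simp [QRoot, hz]

theorem B_root (x : weightLattice Φ) (i : ι) :
    D.B x (rootP Φ i) = D.Q (rootP Φ i) * pair x i := by
  have hB : ∀ u v, D.B u v = D.Q.polarBilin u v := fun u v => rfl
  have h1 : D.B (refl i x) (refl i (rootP Φ i)) = D.B x (rootP Φ i) := by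
    have e : refl i x + refl i (rootP Φ i) = refl i (x + rootP Φ i) := by
      simp only [refl, pair_add, add_smul]; abel
    simp only [B, e, D.Q_refl]
  have h2 : refl i (rootP Φ i) = -rootP Φ i := by
    simp only [refl, pair_root_self, two_smul]; abel
  have h3 : D.B (rootP Φ i) (rootP Φ i) = 2 * D.Q (rootP Φ i) := by
    rw [hB, QuadraticMap.polarBilin_apply_apply, QuadraticMap.polar_self]
    simp [two_smul, two_mul]
  rw [h2, hB, hB, refl, map_neg, map_sub, LinearMap.sub_apply, map_smul, LinearMap.smul_apply,
    ← hB, ← hB, h3, zsmul_eq_mul] at h1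
  linarith

/-- The integer `B(x, α)` for a weight `x` and a root `α`. -/
def BRoot (x : weightLattice Φ) (i : ι) : ℤ := ⌊D.B x (rootP Φ i)⌋

theorem BRoot_eq (x : weightLattice Φ) (i : ι) : D.BRoot x i = D.QRoot i * pair x i := by
  rw [BRoot, B_root, ← cast_QRoot, ← Int.cast_mul, Int.floor_intCast]

theorem cast_BRoot (x : weightLattice Φ) (i : ι) : (D.BRoot x i : ℚ) = D.B x (rootP Φ i) := by
  rw [BRoot_eq, B_root, Int.cast_mul, cast_QRoot]

/-- `m(α) = n / gcd(n, Q(α))`. -/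
def m (i : ι) : ℕ := D.n / Int.gcd D.n (D.QRoot i)

theorem m_mul_gcd (i : ι) : D.m i * Int.gcd D.n (D.QRoot i) = D.n :=
  Nat.div_mul_cancel (Int.natCast_dvd_natCast.mp (Int.gcd_dvd_left _ _))

theorem m_pos (i : ι) : 0 < D.m i := by
  have h := D.m_mul_gcd i
  have h0 := D.n_pos
  rcases Nat.eq_zero_or_pos (D.m i) with h1 | h1
  · rw [h1] at h; omega
  · exact h1

/-- `n ∣ Q(α) t` if and only if `m(α) ∣ t`. -/
theorem n_dvd_iff (i : ι) (t : ℤ) : (D.n : ℤ) ∣ D.QRoot i * t ↔ (D.m i : ℤ) ∣ t := by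
  have hg : (0 : ℤ) < Int.gcd D.n (D.QRoot i) :=
    Int.natCast_pos.mpr (Int.gcd_pos_of_ne_zero_left _ (by have := D.n_pos; omega))
  obtain ⟨c, hc⟩ := Int.gcd_dvd_right (D.n : ℤ) (D.QRoot i)
  have hn : (D.n : ℤ) = Int.gcd D.n (D.QRoot i) * D.m i := by
    have := D.m_mul_gcd i
    rw [mul_comm]; exact_mod_cast this.symm
  have hcop : IsCoprime (D.m i : ℤ) c := by
    rw [Int.isCoprime_iff_gcd_eq_one]
    have h := Int.gcd_mul_left (Int.gcd (D.n : ℤ) (D.QRoot i) : ℤ) (D.m i) c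
    rw [← hn, ← hc, Int.natAbs_natCast] at h
    have hg' : 0 < Int.gcd D.n (D.QRoot i) := by exact_mod_cast hg
    exact (Nat.eq_of_mul_eq_mul_left hg' (by rw [mul_one]; exact h)).symm
  have e : D.QRoot i * t = Int.gcd D.n (D.QRoot i) * (c * t) := by
    rw [← mul_assoc, ← hc]
  have h0 : (D.n : ℤ) ∣ D.QRoot i * t ↔
      (Int.gcd D.n (D.QRoot i) : ℤ) * D.m i ∣ Int.gcd D.n (D.QRoot i) * (c * t) := by
    rw [← e, ← hn]
  rw [h0, mul_dvd_mul_iff_left hg.ne']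
  exact ⟨fun h => hcop.dvd_of_dvd_mul_left h, fun h => h.mul_left c⟩

theorem rootP_reflectionPerm (i j : ι) : rootP Φ (Φ.reflectionPerm i j) = refl i (rootP Φ j) := by
  apply Subtype.ext
  rw [coe_refl]
  exact Φ.root_reflectionPerm i j

theorem m_reflectionPerm (i j : ι) : D.m (Φ.reflectionPerm i j) = D.m j := by
  simp only [m, QRoot, rootP_reflectionPerm, D.Q_refl]

/-- The weight lattice `P^m ⊆ P` of the root system `Φ^m = {m(α) α | α ∈ Φ}`, whose coroots
are `m(α)⁻¹ α^∨`: the weights `x` with `(x, α^∨) ∈ m(α) ℤ` for all roots `α`. -/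
def Pm : AddSubgroup (weightLattice Φ) where
  carrier := {x | ∀ i, (D.m i : ℤ) ∣ pair x i}
  zero_mem' i := by simp [pair_zero]
  add_mem' {x y} hx hy i := by rw [pair_add]; exact dvd_add (hx i) (hy i)
  neg_mem' {x} hx i := by rw [pair_neg]; exact (dvd_neg).mpr (hx i)

/-- `P^m` is the weight lattice of `Φ^m`: it consists of the `v ∈ E` such that
`2 (v, β) / ‖β‖²` is an integer for all `β = m(α) α` in `Φ^m`. -/
theorem mem_Pm_iff (hΦ : IsEuclidean Φ) (v : E) :
    (∃ x ∈ D.Pm, (x : E) = v) ↔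
      ∀ i, ∃ z : ℤ, 2 * inner ℝ v ((D.m i : ℝ) • Φ.root i) / ‖(D.m i : ℝ) • Φ.root i‖ ^ 2 = z := by
  have hm : ∀ i, (D.m i : ℝ) ≠ 0 := fun i => by exact_mod_cast (D.m_pos i).ne'
  have hr : ∀ i, ‖Φ.root i‖ ≠ 0 := fun i => norm_ne_zero_iff.mpr (Φ.ne_zero i)
  have key : ∀ i, 2 * inner ℝ v ((D.m i : ℝ) • Φ.root i) / ‖(D.m i : ℝ) • Φ.root i‖ ^ 2
      = Φ.toLinearMap v (Φ.coroot i) / D.m i := by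
    intro i
    have h1 := hm i
    have h2 := hr i
    rw [hΦ.pairing_eq, hΦ.coroot_eq, inner_smul_right, inner_smul_right, norm_smul,
      Real.norm_natCast]
    field_simp
  simp only [key]
  constructor
  · rintro ⟨x, hx, rfl⟩ i
    obtain ⟨z, hz⟩ := hx i
    refine ⟨z, ?_⟩
    rw [← cast_pair, hz]
    have := hm i
    push_cast
    field_simp
  · intro h
    have h' : ∀ i, ∃ z : ℤ, Φ.toLinearMap v (Φ.coroot i) = D.m i * z := by
      intro i
      obtain ⟨z, hz⟩ := h i
      exact ⟨z, by rw [← hz, mul_div_cancel₀ _ (hm i)]⟩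
    have hv : v ∈ weightLattice Φ := fun i => by
      obtain ⟨z, hz⟩ := h' i
      exact ⟨D.m i * z, by rw [hz]; push_cast; rfl⟩
    refine ⟨⟨v, hv⟩, fun i => ?_, rfl⟩
    obtain ⟨z, hz⟩ := h' i
    refine ⟨z, ?_⟩
    have : (pair (⟨v, hv⟩ : weightLattice Φ) i : ℝ) = D.m i * z := (cast_pair _ _).trans hz
    exact_mod_cast this

/-- The root `α^m = m(α) α` of `Φ^m`, as an element of `P`. -/
def rootM (i : ι) : weightLattice Φ := D.m i • rootP Φ i

theorem rootM_mem (i : ι) : D.rootM i ∈ D.Pm := by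
  intro j
  have hB : D.QRoot j * pair (rootP Φ i) j = D.QRoot i * pair (rootP Φ j) i := by
    have h : D.B (rootP Φ i) (rootP Φ j) = D.B (rootP Φ j) (rootP Φ i) := by
      simp only [B, add_comm (rootP Φ i)]; ring
    rw [B_root, B_root, ← cast_QRoot, ← cast_QRoot] at h
    exact_mod_cast h
  rw [rootM, ← natCast_zsmul, pair_zsmul, ← n_dvd_iff]
  have h2 : (D.n : ℤ) ∣ D.QRoot i * (D.m i : ℤ) := (D.n_dvd_iff i _).mpr dvd_rfl
  have e : D.QRoot j * ((D.m i : ℤ) * pair (rootP Φ i) j)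
      = D.QRoot i * (D.m i : ℤ) * pair (rootP Φ j) i := by
    rw [mul_left_comm, hB]; ring
  rw [e]
  exact h2.mul_right _

theorem refl_mem (i : ι) {x : weightLattice Φ} (hx : x ∈ D.Pm) : refl i x ∈ D.Pm := by
  intro j
  rw [pair_refl, ← D.m_reflectionPerm i j]
  exact hx _

/-- The reflection `s_α` on `P^m`. -/
def reflM (i : ι) (x : D.Pm) : D.Pm := ⟨refl i x, D.refl_mem i x.2⟩

/-- The divided difference operator of `ℂ[P^m]`,
`∇ x^ν = (1 - x^(-(ν, α^{m∨}) α^m)) / (1 - x^(α^m)) * x^ν = (x^ν - x^(s_α ν)) / (1 - x^(α^m))`;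
here `(ν, α^{m∨}) = (ν, α^∨) / m(α)`. -/
def nablaM (i : ι) : AddMonoidAlgebra ℂ D.Pm →ₗ[ℂ] AddMonoidAlgebra ℂ D.Pm :=
  linExt fun ν => geomQuot (⟨D.rootM i, D.rootM_mem i⟩ : D.Pm) (pair ν.1 i / D.m i) * mon ν

theorem one_sub_mul_nablaM (i : ι) (ν : D.Pm) :
    (1 - mon (⟨D.rootM i, D.rootM_mem i⟩ : D.Pm)) * D.nablaM i (mon ν)
      = mon ν - mon (D.reflM i ν) := by
  have e : -((pair ν.1 i / (D.m i : ℤ)) • (⟨D.rootM i, D.rootM_mem i⟩ : D.Pm)) + ν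
      = D.reflM i ν := by
    apply Subtype.ext
    obtain ⟨c, hc⟩ := ν.2 i
    have hm : (D.m i : ℤ) ≠ 0 := by have := D.m_pos i; omega
    simp only [AddSubgroup.coe_add, AddSubgroup.coe_neg, AddSubgroup.coe_zsmul, reflM, refl, rootM]
    rw [hc, Int.mul_ediv_cancel_left _ hm, ← natCast_zsmul, smul_smul, mul_comm c]
    abel
  rw [nablaM, linExt_mon, ← mul_assoc, one_sub_mul_geomQuot, sub_mul, one_mul, mon_mul, e]

/-- The metaplectic divided difference operator of `ℂ[P]`,
`x^λ ↦ (1 - x^(-(q(λ), α^{m∨}) α^m)) / (1 - x^(α^m)) * x^λ`; here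
`(q(λ), α^{m∨}) = ((λ, α^∨) - r) / m(α)`, with `r` the remainder of `(λ, α^∨)` modulo `m(α)`,
is the integer quotient of `(λ, α^∨)` by `m(α)`. -/
def nablaBar (i : ι) :
    AddMonoidAlgebra ℂ (weightLattice Φ) →ₗ[ℂ] AddMonoidAlgebra ℂ (weightLattice Φ) :=
  linExt fun x => geomQuot (D.rootM i) (pair x i / D.m i) * mon x

/-- `nablaBar` maps `x^λ` to `(x^λ - x^(s_α λ + r α)) / (1 - x^(m(α) α))`, with `r` the
remainder of `(λ, α^∨)` modulo `m(α)`. -/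
theorem one_sub_mul_nablaBar (i : ι) (x : weightLattice Φ) :
    (1 - mon (D.rootM i)) * D.nablaBar i (mon x)
      = mon x - mon (refl i x + (pair x i % D.m i) • rootP Φ i) := by
  have e : -((pair x i / (D.m i : ℤ)) • D.rootM i) + x
      = refl i x + (pair x i % D.m i) • rootP Φ i := by
    have h := Int.emod_add_mul_ediv (pair x i) (D.m i)
    rw [refl, rootM, ← natCast_zsmul, smul_smul]
    nth_rewrite 2 [← h]
    rw [add_smul, mul_comm (D.m i : ℤ)]
    abel
  rw [nablaBar, linExt_mon, ← mul_assoc, one_sub_mul_geomQuot, sub_mul, one_mul, mon_mul, e]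

end Datum

end Roots

/-! ### The extended affine Hecke algebra -/

section Hecke

variable {ι E : Type*} [NormedAddCommGroup E] [InnerProductSpace ℝ E]
variable {Φ : RootPairing ι ℝ E E} [Φ.IsCrystallographic]

/-- Linear extension of `ν ↦ x^ν` to a map from `ℂ[P^m]` to the free algebra on symbols
`T_i` (`i` a simple root) and `x^ν` (`ν ∈ P^m`). -/
def freeX (D : Datum Φ) (b : Φ.Base) :
    AddMonoidAlgebra ℂ D.Pm →ₗ[ℂ] FreeAlgebra ℂ (b.support ⊕ D.Pm) :=
  linExt fun ν => FreeAlgebra.ι ℂ (Sum.inr ν)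

/-- The symbol `T_i` in the free algebra. -/
def freeT (D : Datum Φ) (b : Φ.Base) (i : b.support) : FreeAlgebra ℂ (b.support ⊕ D.Pm) :=
  FreeAlgebra.ι ℂ (Sum.inl i)

/-- The defining relations of the extended affine Hecke algebra: the quadratic and braid
relations of the finite Hecke algebra, the relations of the group algebra `ℂ[P^m]`, and the
Bernstein-Zelevinsky cross relations. In the braid relation for `i ≠ j` the number of factors is
the order of `s_i s_j`. -/
inductive HeckeRel (D : Datum Φ) (b : Φ.Base) (k : ι → ℂˣ) :
    FreeAlgebra ℂ (b.support ⊕ D.Pm) → FreeAlgebra ℂ (b.support ⊕ D.Pm) → Prop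
  | quadratic (i : b.support) :
      HeckeRel D b k
        ((freeT D b i - algebraMap ℂ _ (k i : ℂ)) * (freeT D b i + algebraMap ℂ _ (k i : ℂ)⁻¹)) 0
  | braid (i j : b.support) (hij : i ≠ j) :
      HeckeRel D b k
        (altProd (freeT D b i) (freeT D b j) (orderOf (Φ.reflection i * Φ.reflection j)))
        (altProd (freeT D b j) (freeT D b i) (orderOf (Φ.reflection i * Φ.reflection j)))
  | x_zero : HeckeRel D b k (freeX D b (mon 0)) 1
  | x_add (μ ν : D.Pm) :
      HeckeRel D b k (freeX D b (mon μ) * freeX D b (mon ν)) (freeX D b (mon (μ + ν)))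
  | cross (i : b.support) (ν : D.Pm) :
      HeckeRel D b k
        (freeT D b i * freeX D b (mon ν) - freeX D b (mon (D.reflM i ν)) * freeT D b i)
        (((k i : ℂ) - (k i : ℂ)⁻¹) • freeX D b (D.nablaM i (mon ν)))

/-- The extended affine Hecke algebra attached to `Φ^m` with Hecke parameters `k`: the unital
associative algebra over `ℂ` generated by the finite Hecke algebra and the group algebra
`ℂ[P^m]`, subject to the Bernstein-Zelevinsky cross relations. -/
abbrev AffineHecke (D : Datum Φ) (b : Φ.Base) (k : ι → ℂˣ) : Type _ :=
  RingQuot (HeckeRel D b k)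

/-- The generator `T_i` of the extended affine Hecke algebra. -/
def heckeT (D : Datum Φ) (b : Φ.Base) (k : ι → ℂˣ) (i : b.support) : AffineHecke D b k :=
  RingQuot.mkAlgHom ℂ (HeckeRel D b k) (freeT D b i)

/-- The element `x^ν` of the extended affine Hecke algebra. -/
def heckeX (D : Datum Φ) (b : Φ.Base) (k : ι → ℂˣ) (ν : D.Pm) : AffineHecke D b k :=
  RingQuot.mkAlgHom ℂ (HeckeRel D b k) (freeX D b (mon ν))

end Hecke

/-! ### Representation parameters -/

/-- The two possible sizes of roots: short and long. -/
inductive RootSize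
  | sh
  | lg

section Parameters

variable {ι E : Type*} [NormedAddCommGroup E] [InnerProductSpace ℝ E]
variable {Φ : RootPairing ι ℝ E E} [Φ.IsCrystallographic]

open Classical in
/-- The size of the root `α^m` of `Φ^m`: short if some root of `Φ^m` is strictly longer than
`α^m`, and long otherwise. All roots are long if they have the same length. -/
def Datum.size (D : Datum Φ) (i : ι) : RootSize :=
  if ∃ j, ‖(D.rootM i : E)‖ < ‖(D.rootM j : E)‖ then RootSize.sh else RootSize.lg

/-- Representation parameters `g_j(y)`, for `j ∈ ℤ` and `y` a size of roots. In the last condition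
`y` is the size of a root `α^m`, and `k_α` is the common value of `k` at the roots of that
size. -/
structure IsRepParam (D : Datum Φ) (k : ι → ℂˣ) (g : ℤ → RootSize → ℂˣ) : Prop where
  eq_neg_one : ∀ (j : ℤ) (y : RootSize), (D.n : ℤ) ∣ j → g j y = -1
  periodic : ∀ (j : ℤ) (y : RootSize), g j y = g (j % D.n) y
  mul_eq : ∀ (j : ℤ) (α : ι), ¬ (D.n : ℤ) ∣ j →
    g j (D.size α) * g (D.n - j) (D.size α) = (k α ^ 2)⁻¹

/-- The function `p_α(λ̄) = -k_α g_{-B(λ, α)}(size(α^m))` on `P / P^m`. -/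
def pFun (D : Datum Φ) {k : ι → ℂˣ} {g : ℤ → RootSize → ℂˣ} (hg : IsRepParam D k g) (i : ι) :
    (weightLattice Φ ⧸ D.Pm) → ℂ :=
  Quotient.lift (s := QuotientAddGroup.leftRel D.Pm)
    (fun x => -(k i : ℂ) * (g (-D.BRoot x i) (D.size i) : ℂ)) (by
      intro x y hxy
      have h : -x + y ∈ D.Pm := QuotientAddGroup.leftRel_apply.mp hxy
      have h1 := (D.n_dvd_iff i _).mpr (h i)
      have h2 : (-D.BRoot x i) % (D.n : ℤ) = (-D.BRoot y i) % (D.n : ℤ) := by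
        apply Int.ModEq.symm
        rw [Int.modEq_iff_dvd, Datum.BRoot_eq, Datum.BRoot_eq]
        rw [pair_add, pair_neg] at h1
        have e : -(D.QRoot i * pair x i) - -(D.QRoot i * pair y i)
          = D.QRoot i * (-pair x i + pair y i) := by ring
        rw [e]; exact h1
      have h3 : g (-D.BRoot x i) (D.size i) = g (-D.BRoot y i) (D.size i) := by
        rw [hg.periodic, h2, ← hg.periodic]
      simp only [h3])

theorem pFun_mk (D : Datum Φ) {k : ι → ℂˣ} {g : ℤ → RootSize → ℂˣ} (hg : IsRepParam D k g)
    (i : ι) (x : weightLattice Φ) :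
    pFun D hg i (x : weightLattice Φ ⧸ D.Pm)
      = -(k i : ℂ) * (g (-D.BRoot x i) (D.size i) : ℂ) := rfl

end Parameters

end

end Metaplectic

/-! The algebra is given by generators and relations, so π is unique, and it exists once the
operators `opT` and `opX` satisfy the relations. The cross relation (`opT_mul_opX`) is formal: a
shift by ν ∈ P^m moves the integer quotient inside `nablaBar` by an integer and does not change p_i.
The other relations say that some operator Δ vanishes, and the proof shows that ker Δ is too large
to be proper.

Quadratic relation (`opT_mul_self`): Δ commutes with x^ν for a ν ∈ P^m with (ν, α_i^∨) = m(α_i), so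
it is enough to evaluate Δ at x^μ with 0 ≤ (μ, α_i^∨) < m(α_i). There the conditions on g finish the
computation.

Braid relation (`opT_braid`): let Δ be the difference of the two words. By the quadratic relations
ker Δ is stable under T_i and T_j (`altProd_sub_mul_even`, `altProd_sub_mul_three`). By the cross
relations Δ x^ν = x^{w₀ν} Δ, where w₀ is the longest element of the rank two group and ν the
fundamental weight of the short root of Φ^m. So ker Δ is stable under x^{±ν}, and then under
translation by α_i^m and α_j^m. If μ lies in the closed fundamental alcove of Φ^m, every T in either
word reflects the monomial up to a scalar. These scalars are Weyl equivariant (`coef_refl`), so both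
words yield the same product over the positive roots, and x^μ ∈ ker Δ. Reflections and translations
bring every weight into the alcove (`alcove_descent`), hence ker Δ is everything
(`eq_top_of_alcove`). For orthogonal roots a box replaces the alcove (`opT_braid_two`). -/

namespace Metaplectic

/-! ### Words in two generators satisfying quadratic relations -/

section Dihedral

variable {A : Type*} [Ring A] [Algebra ℂ A]

/-- In even length exactly one word begins with `a` and the other ends with `a`. Multiplication by
`a` on either side therefore extends one word and collapses the other by the quadratic relation. If
`a` and `b` are operators, the kernel of the difference is stable under `a` (`ker_stable`). -/
theorem altProd_sub_mul_even {a b : A} {s : ℂ} (ha : a * a = s • a + 1) {n : ℕ}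
    (hn : n = 2 ∨ n = 4 ∨ n = 6) :
    (altProd a b n - altProd b a n) * a =
      s • (altProd a b n - altProd b a n) - a * (altProd a b n - altProd b a n) := by
  have ha' : ∀ x, a * (a * x) = s • (a * x) + x := fun x => by
    rw [← mul_assoc, ha, add_mul, one_mul, smul_mul_assoc]
  rcases hn with rfl | rfl | rfl <;>
  · simp only [altProd, mul_one, sub_mul, mul_sub, smul_sub, mul_assoc, ha, ha', mul_add,
      mul_smul_comm]
    module

/-- In odd length a word begins and ends with the same letter, so `a` on the right is traded for `b`
on the left. This needs the same `s` for both letters. -/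
theorem altProd_sub_mul_three {a b : A} {s : ℂ} (ha : a * a = s • a + 1)
    (hb : b * b = s • b + 1) :
    (altProd a b 3 - altProd b a 3) * a =
      s • (altProd a b 3 - altProd b a 3) - b * (altProd a b 3 - altProd b a 3) := by
  have hb' : ∀ x, b * (b * x) = s • (b * x) + x := fun x => by
    rw [← mul_assoc, hb, add_mul, one_mul, smul_mul_assoc]
  simp only [altProd, mul_one, sub_mul, mul_sub, smul_sub, mul_assoc, ha, hb', mul_add,
    mul_smul_comm]
  module

/-- A form of the hypothesis that `simp` can apply inside right-nested products, to move every `x`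
to the left of a word. -/
theorem assoc_rule {a x y : A} {s : ℂ} (h : a * x = y * (a - algebraMap ℂ A s)) (z : A) :
    a * (x * z) = y * (a * z) - s • (y * z) := by
  rw [← mul_assoc, h, mul_assoc, sub_mul, mul_sub, Algebra.smul_def, Algebra.left_comm]

/-- In this and the next three lemmas, `x₀, x₁, …` stand for x^λ with λ = ν, s_i ν, s_j s_i ν, …,
where ν is orthogonal to α_j; the last one is x^{w₀ν}. Each word carries `x₀` to the last element up
to lower terms, and these agree for the two words, by the quadratic relations when the length
exceeds two. -/
theorem altProd_two_semilinear {a b x₀ x₁ : A} {s : ℂ}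
    (h₀ : a * x₀ = x₁ * (a - algebraMap ℂ A s)) (h₀' : b * x₀ = x₀ * b) (h₁ : b * x₁ = x₁ * b) :
    (altProd a b 2 - altProd b a 2) * x₀ = x₁ * (altProd a b 2 - altProd b a 2) := by
  have r₀ := assoc_rule h₀
  have r₁ : ∀ z, b * (x₁ * z) = x₁ * (b * z) := fun z => by rw [← mul_assoc, h₁, mul_assoc]
  rw [mul_sub, ← Algebra.commutes, ← Algebra.smul_def] at h₀
  simp only [altProd, mul_one, sub_mul, mul_sub, mul_assoc, h₀, h₀', h₁, r₀, r₁, mul_smul_comm]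
  module

theorem altProd_three_semilinear {a b x₀ x₁ x₂ : A} {s : ℂ} (ha : a * a = s • a + 1)
    (hb : b * b = s • b + 1)
    (h₀ : a * x₀ = x₁ * (a - algebraMap ℂ A s)) (h₀' : b * x₀ = x₀ * b)
    (h₁ : b * x₁ = x₂ * (b - algebraMap ℂ A s)) (h₂ : a * x₂ = x₂ * a) :
    (altProd a b 3 - altProd b a 3) * x₀ = x₂ * (altProd a b 3 - altProd b a 3) := by
  have r₀ := assoc_rule h₀
  have r₁ := assoc_rule h₁
  have r₂ : ∀ z, a * (x₂ * z) = x₂ * (a * z) := fun z => by rw [← mul_assoc, h₂, mul_assoc]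
  rw [mul_sub, ← Algebra.commutes, ← Algebra.smul_def] at h₀ h₁
  simp only [altProd, mul_one, sub_mul, mul_sub, mul_assoc, h₀, h₀', h₁, h₂, r₀, r₁, r₂,
    mul_smul_comm, ha, hb, mul_add, smul_sub]
  module

theorem altProd_four_semilinear {a b x₀ x₁ x₂ x₃ : A} {s t : ℂ} (ha : a * a = s • a + 1)
    (hb : b * b = t • b + 1)
    (h₀ : a * x₀ = x₁ * (a - algebraMap ℂ A s)) (h₀' : b * x₀ = x₀ * b)
    (h₁ : b * x₁ = x₂ * (b - algebraMap ℂ A t)) (h₂ : a * x₂ = x₃ * (a - algebraMap ℂ A s))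
    (h₃ : b * x₃ = x₃ * b) :
    (altProd a b 4 - altProd b a 4) * x₀ = x₃ * (altProd a b 4 - altProd b a 4) := by
  have r₀ := assoc_rule h₀
  have r₁ := assoc_rule h₁
  have r₂ := assoc_rule h₂
  have r₃ : ∀ z, b * (x₃ * z) = x₃ * (b * z) := fun z => by rw [← mul_assoc, h₃, mul_assoc]
  rw [mul_sub, ← Algebra.commutes, ← Algebra.smul_def] at h₀ h₁ h₂
  have ha' : ∀ x, a * (a * x) = s • (a * x) + x := fun x => by
    rw [← mul_assoc, ha, add_mul, one_mul, smul_mul_assoc]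
  have hb' : ∀ x, b * (b * x) = t • (b * x) + x := fun x => by
    rw [← mul_assoc, hb, add_mul, one_mul, smul_mul_assoc]
  simp only [altProd, mul_one, sub_mul, mul_sub, mul_assoc, h₀, h₀', h₁, h₂, h₃, r₀, r₁, r₂, r₃,
    mul_smul_comm, ha, hb, ha', hb', mul_add, smul_sub]
  module

/-- For G₂ the weight ν is only quasi-minuscule: the middle step crosses a string of length two,
whose central weight is orthogonal to both roots. It contributes `y`, which commutes with `a` and
`b`. -/
theorem altProd_six_semilinear {a b x₀ x₁ x₂ x₃ x₄ x₅ y : A} {s t : ℂ} (ha : a * a = s • a + 1)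
    (hb : b * b = t • b + 1)
    (h₀ : a * x₀ = x₁ * (a - algebraMap ℂ A s)) (h₀' : b * x₀ = x₀ * b)
    (h₁ : b * x₁ = x₂ * (b - algebraMap ℂ A t))
    (h₂ : a * x₂ = x₃ * (a - algebraMap ℂ A s) - s • y)
    (h₃ : b * x₃ = x₄ * (b - algebraMap ℂ A t))
    (h₄ : a * x₄ = x₅ * (a - algebraMap ℂ A s)) (h₅ : b * x₅ = x₅ * b)
    (hya : a * y = y * a) (hyb : b * y = y * b) :
    (altProd a b 6 - altProd b a 6) * x₀ = x₅ * (altProd a b 6 - altProd b a 6) := by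
  have r₀ := assoc_rule h₀
  have r₁ := assoc_rule h₁
  have r₂ : ∀ z, a * (x₂ * z) = x₃ * (a * z) - s • (x₃ * z) - s • (y * z) := fun z => by
    rw [← mul_assoc, h₂, sub_mul, mul_assoc, sub_mul, mul_sub, Algebra.smul_def s (x₃ * z),
      Algebra.left_comm, smul_mul_assoc]
  have r₃ := assoc_rule h₃
  have r₄ := assoc_rule h₄
  have r₅ : ∀ z, b * (x₅ * z) = x₅ * (b * z) := fun z => by rw [← mul_assoc, h₅, mul_assoc]
  have ra : ∀ z, a * (y * z) = y * (a * z) := fun z => by rw [← mul_assoc, hya, mul_assoc]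
  have rb : ∀ z, b * (y * z) = y * (b * z) := fun z => by rw [← mul_assoc, hyb, mul_assoc]
  rw [mul_sub, ← Algebra.commutes, ← Algebra.smul_def] at h₀ h₁ h₂ h₃ h₄
  have ha' : ∀ x, a * (a * x) = s • (a * x) + x := fun x => by
    rw [← mul_assoc, ha, add_mul, one_mul, smul_mul_assoc]
  have hb' : ∀ x, b * (b * x) = t • (b * x) + x := fun x => by
    rw [← mul_assoc, hb, add_mul, one_mul, smul_mul_assoc]
  simp only [altProd, mul_one, sub_mul, mul_sub, mul_assoc, h₀, h₀', h₁, h₂, h₃, h₄, h₅, r₀, r₁,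
    r₂, r₃, r₄, r₅, ra, rb, hya, hyb, mul_smul_comm, ha, hb, ha', hb', mul_add, smul_sub,
    smul_add]
  module

end Dihedral

/-! ### Descent to the fundamental alcove in rank two -/

/-- Every point of the weight lattice of a rank two root system is moved to the closed fundamental
alcove, of size `L`, by reflections and translations by weights; `c` is the product of the
off-diagonal entries of the Cartan matrix. -/
theorem alcove_descent {c L : ℤ} (hL : 0 < L) {G : ℤ → ℤ → Prop}
    (h₁ : ∀ U V, G (-U) (V + U) → G U V) (h₂ : ∀ U V, G (U + c * V) (-V) → G U V)
    (h₃ : ∀ U V, G (U + L) V → G U V) (h₄ : ∀ U V, G U (V + L) → G U V)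
    (h : c = 1 ∧ (∀ U V, 0 ≤ U → 0 ≤ V → U + V ≤ L → G U V) ∨
      c = 2 ∧ (∀ U V, 0 ≤ U → 0 ≤ V → U + 2 * V ≤ L → G U V) ∨
      c = 3 ∧ (∀ U V, 0 ≤ U → 0 ≤ V → 2 * U + 3 * V ≤ L → G U V)) (U V : ℤ) : G U V := by
  -- The quadratic part is invariant under both reflections, and the linear part is strictly
  -- dominant, so reflecting in a violated wall U < 0 or V < 0 lowers `f`. The factor 100 lets the
  -- norm outweigh the linear part beyond the affine wall; the constant term keeps `f` nonnegative.
  let f : ℤ → ℤ → ℤ := fun U V =>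
    100 * (U ^ 2 + c * U * V + c * V ^ 2) - ((2 + c) * U + 3 * c * V) + 100
  have hf : ∀ U V, 0 ≤ f U V := by
    intro U V
    rcases h with ⟨rfl, -⟩ | ⟨rfl, -⟩ | ⟨rfl, -⟩
    · simp only [f]; nlinarith [sq_nonneg (2 * U + V), sq_nonneg (U - 1), sq_nonneg (V - 1)]
    · simp only [f]; nlinarith [sq_nonneg (U + V), sq_nonneg (U - 1), sq_nonneg (V - 1), sq_nonneg V]
    · simp only [f]
      nlinarith [sq_nonneg (2 * U + 3 * V), sq_nonneg (U - 1), sq_nonneg (V - 1),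
        sq_nonneg (3 * U + 5 * V)]
  suffices H : ∀ n : ℕ, ∀ U V, f U V = n → G U V by
    obtain ⟨n, hn⟩ := Int.eq_ofNat_of_zero_le (hf U V)
    exact H n U V hn
  intro n
  induction n using Nat.strongRecOn with
  | ind n ih =>
  intro U V hn
  have step : ∀ U' V', f U' V' < f U V → G U' V' := by
    intro U' V' hlt
    obtain ⟨m, hm⟩ := Int.eq_ofNat_of_zero_le (hf U' V')
    exact ih m (by omega) U' V' hm
  have hc : 0 < c ∧ c < 4 := by omega
  rcases lt_or_ge U 0 with hU | hU
  · refine h₁ _ _ (step _ _ ?_)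
    simp only [f]
    nlinarith [mul_pos hc.1 (neg_pos.mpr hU), mul_pos (sub_pos.mpr hc.2) (neg_pos.mpr hU)]
  rcases lt_or_ge V 0 with hV | hV
  · refine h₂ _ _ (step _ _ ?_)
    simp only [f]
    nlinarith [mul_pos (mul_pos hc.1 (sub_pos.mpr hc.2)) (neg_pos.mpr hV)]
  rcases h with ⟨rfl, h⟩ | ⟨rfl, h⟩ | ⟨rfl, h⟩
  · rcases le_or_gt (U + V) L with h' | h'
    · exact h _ _ hU hV h'
    -- The composite is the reflection in the affine wall U + V = L, here (U, V) ↦ (L - V, L - U).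
    -- The other two cases are built in the same way from their highest coroot.
    · refine h₁ _ _ (h₂ _ _ (h₁ _ _ (h₃ _ _ (h₄ _ _ (step _ _ ?_)))))
      simp only [f]
      nlinarith [mul_pos (sub_pos.mpr h') hL]
  · rcases le_or_gt (U + 2 * V) L with h' | h'
    · exact h _ _ hU hV h'
    · refine h₂ _ _ (h₁ _ _ (h₂ _ _ (h₄ _ _ (step _ _ ?_))))
      simp only [f]
      nlinarith [mul_pos (sub_pos.mpr h') hL]
  · rcases le_or_gt (2 * U + 3 * V) L with h' | h'
    · exact h _ _ hU hV h'
    · refine h₁ _ _ (h₂ _ _ (h₁ _ _ (h₂ _ _ (h₁ _ _ (h₃ _ _ (step _ _ ?_))))))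
      simp only [f]
      nlinarith [mul_pos (sub_pos.mpr h') hL]


/-! ### Identities for geometric quotients -/

section GroupAlgebra

variable {G V : Type*} [AddCommGroup G] [AddCommGroup V] [Module ℂ V]

theorem mon_hom_ext {f h : AddMonoidAlgebra ℂ G →ₗ[ℂ] V} (H : ∀ a, f (mon a) = h (mon a)) :
    f = h := by
  refine LinearMap.ext fun x => ?_
  induction x using AddMonoidAlgebra.induction_linear with
  | zero => simp
  | add x y hx hy => rw [map_add, map_add, hx, hy]
  | single a r =>
    have e : (AddMonoidAlgebra.single a r : AddMonoidAlgebra ℂ G) = r • mon a := by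
      simp [mon]
    rw [e, map_smul, map_smul, H]

theorem geomQuot_zero (β : G) : geomQuot β 0 = 0 := by simp [geomQuot]

theorem geomQuot_succ (β : G) (N : ℤ) :
    geomQuot β (N + 1) = geomQuot β N - mon (-((N + 1) • β)) := by
  rcases le_or_gt 0 N with h | h
  · obtain ⟨n, rfl⟩ := Int.eq_ofNat_of_zero_le h
    have e₁ : (-((n : ℤ) + 1)).toNat = 0 := by omega
    have e₂ : ((n : ℤ) + 1).toNat = n + 1 := by omega
    have e₃ : (-(n : ℤ)).toNat = 0 := by omega
    have e₄ : ((n : ℤ) + 1) • β = (n + 1) • β := by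
      rw [← natCast_zsmul]; push_cast; rfl
    rw [geomQuot, geomQuot, e₁, e₂, e₃, Int.toNat_natCast, Finset.sum_range_succ, e₄]
    abel
  · obtain ⟨n, hn⟩ := Int.eq_ofNat_of_zero_le (show 0 ≤ -N - 1 by omega)
    obtain rfl : N = -((n : ℤ) + 1) := by omega
    have e₁ : (-(-((n : ℤ) + 1) + 1)).toNat = n := by omega
    have e₂ : (-((n : ℤ) + 1) + 1).toNat = 0 := by omega
    have e₃ : (- -((n : ℤ) + 1)).toNat = n + 1 := by omega
    have e₄ : (-((n : ℤ) + 1)).toNat = 0 := by omega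
    have e₅ : -((-((n : ℤ) + 1) + 1) • β) = n • β := by
      rw [← natCast_zsmul, ← neg_smul]; congr 1; ring
    rw [geomQuot, geomQuot, e₁, e₂, e₃, e₄, Finset.sum_range_succ, e₅]
    abel

theorem geomQuot_one (β : G) : geomQuot β 1 = -mon (-β) := by
  have := geomQuot_succ β 0
  simpa [geomQuot_zero] using this

theorem geomQuot_two (β : G) : geomQuot β 2 = -mon (-β) - mon (-((2 : ℤ) • β)) := by
  have := geomQuot_succ β 1
  rwa [geomQuot_one] at this

theorem geomQuot_neg_one (β : G) : geomQuot β (-1) = 1 := by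
  have := geomQuot_succ β (-1)
  rw [neg_add_cancel, geomQuot_zero, zero_smul, neg_zero, mon_zero] at this
  exact (sub_eq_zero.mp this.symm)

/-- The cocycle identity behind the cross relation. Induction replaces cancelling 1 - x^β, which may
be a zero divisor in ℂ[G]. -/
theorem geomQuot_add (β : G) (N c : ℤ) :
    geomQuot β (N + c) = geomQuot β c + mon (-(c • β)) * geomQuot β N := by
  induction N using Int.induction_on with
  | zero => simp [geomQuot_zero]
  | succ n ih =>
    rw [show (n : ℤ) + 1 + c = n + c + 1 by ring, geomQuot_succ, ih, geomQuot_succ β n, mul_sub,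
      mon_mul, show -(((n : ℤ) + c + 1) • β) = -(c • β) + -(((n : ℤ) + 1) • β) by module]
    ring
  | pred n ih =>
    have h₁ := geomQuot_succ β (-(n : ℤ) - 1 + c)
    have h₂ := geomQuot_succ β (-(n : ℤ) - 1)
    rw [show -(n : ℤ) - 1 + c + 1 = -n + c by ring, ih] at h₁
    rw [sub_add_cancel] at h₂
    rw [h₂, mul_sub, mon_mul, show -(c • β) + -((-(n : ℤ)) • β) = -((-(n : ℤ) + c) • β) by module,
      ← add_sub_assoc] at h₁
    exact (sub_left_inj.mp h₁).symm

theorem map_geomQuot {H : Type*} [AddCommGroup H] (φ : G →+ H) (β : G) (N : ℤ) :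
    AddMonoidAlgebra.mapDomainAlgHom ℂ ℂ φ (geomQuot β N) = geomQuot (φ β) N := by
  have h : ∀ a : G, AddMonoidAlgebra.mapDomainAlgHom ℂ ℂ φ (mon a) = mon (φ a) := fun a => by
    simp [mon]
  simp only [geomQuot, map_sub, map_sum, h, map_neg, map_nsmul]

end GroupAlgebra

/-! ### The operators on ℂ[P] and the cross relations -/

section Operators

variable {ι E : Type*} [NormedAddCommGroup E] [InnerProductSpace ℝ E]
variable {Φ : RootPairing ι ℝ E E}

theorem pair_sub (x y : weightLattice Φ) (i : ι) : pair (x - y) i = pair x i - pair y i := by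
  rw [sub_eq_add_neg, pair_add, pair_neg, sub_eq_add_neg]

/-- Multiplication by `x^ν`. -/
noncomputable def opX (ν : weightLattice Φ) :
    Module.End ℂ (AddMonoidAlgebra ℂ (weightLattice Φ)) := LinearMap.mulLeft ℂ (mon ν)

theorem opX_apply (ν : weightLattice Φ) (v : AddMonoidAlgebra ℂ (weightLattice Φ)) :
    opX ν v = mon ν * v := rfl

theorem opX_mon (ν μ : weightLattice Φ) : opX ν (mon μ) = mon (ν + μ) := mon_mul _ _

theorem opX_mul (μ ν : weightLattice Φ) : opX μ * opX ν = opX (μ + ν) := by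
  refine LinearMap.ext fun v => ?_
  rw [Module.End.mul_apply, opX_apply, opX_apply, opX_apply, ← mul_assoc, mon_mul]

theorem opX_zero : opX (0 : weightLattice Φ) = 1 := by
  refine LinearMap.ext fun v => ?_
  rw [opX_apply, mon_zero, one_mul, Module.End.one_apply]

theorem opX_neg_mul (ν : weightLattice Φ) : opX (-ν) * opX ν = 1 := by
  rw [opX_mul, neg_add_cancel, opX_zero]

theorem opX_mul_neg (ν : weightLattice Φ) : opX ν * opX (-ν) = 1 := by
  rw [opX_mul, add_neg_cancel, opX_zero]

variable [Φ.IsCrystallographic]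

theorem refl_add (i : ι) (x y : weightLattice Φ) : refl i (x + y) = refl i x + refl i y := by
  simp only [refl, pair_add, add_smul]; abel

theorem pair_refl_eq (i j : ι) (x : weightLattice Φ) :
    pair (refl i x) j = pair x j - pair x i * pair (rootP Φ i) j := by
  rw [refl, pair_sub, pair_zsmul]

theorem pair_refl_self (i : ι) (x : weightLattice Φ) : pair (refl i x) i = -pair x i := by
  rw [pair_refl_eq, pair_root_self]; ring

theorem refl_refl (i : ι) (x : weightLattice Φ) : refl i (refl i x) = x := by
  rw [refl, pair_refl_self, refl]; module

theorem pair_rootM (D : Datum Φ) (i j : ι) :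
    pair (D.rootM i) j = D.m i * pair (rootP Φ i) j := by
  rw [Datum.rootM, ← natCast_zsmul, pair_zsmul]

theorem refl_eq_sub_rootM (D : Datum Φ) {i : ι} {x : weightLattice Φ} {c : ℤ}
    (hc : pair x i = D.m i * c) : refl i x = x - c • D.rootM i := by
  rw [refl, hc, Datum.rootM, mul_comm, mul_smul, natCast_zsmul]

variable (D : Datum Φ) {k : ι → ℂˣ} {g : ℤ → RootSize → ℂˣ} (hg : IsRepParam D k g)

/-- The operator by which `T_α` acts on `ℂ[P]`. -/
noncomputable def opT (i : ι) : Module.End ℂ (AddMonoidAlgebra ℂ (weightLattice Φ)) :=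
  ((k i : ℂ) - (k i : ℂ)⁻¹) • D.nablaBar i +
    linExt fun μ : weightLattice Φ => pFun D hg i (μ : weightLattice Φ ⧸ D.Pm) • mon (refl i μ)

theorem opT_mon (i : ι) (μ : weightLattice Φ) :
    opT D hg i (mon μ) = ((k i : ℂ) - (k i : ℂ)⁻¹) • D.nablaBar i (mon μ) +
      pFun D hg i (μ : weightLattice Φ ⧸ D.Pm) • mon (refl i μ) := by
  rw [opT, LinearMap.add_apply, LinearMap.smul_apply, linExt_mon]

theorem nablaBar_mon (i : ι) (μ : weightLattice Φ) :
    D.nablaBar i (mon μ) = geomQuot (D.rootM i) (pair μ i / D.m i) * mon μ := by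
  rw [Datum.nablaBar, linExt_mon]

theorem pFun_add_mem (i : ι) (μ : weightLattice Φ) {ν : weightLattice Φ} (hν : ν ∈ D.Pm) :
    pFun D hg i ((ν + μ : weightLattice Φ) : weightLattice Φ ⧸ D.Pm) =
      pFun D hg i (μ : weightLattice Φ ⧸ D.Pm) := by
  congr 1
  rw [QuotientAddGroup.eq]
  simpa [add_comm] using hν

/-- Adding ν shifts the integer quotient in `nablaBar` by exactly `c`, and `geomQuot_add` splits off
the correction. The term with p_i is already semilinear because p_i lives on P/P^m. -/
theorem opT_mul_opX (i : ι) {ν : weightLattice Φ} (hν : ν ∈ D.Pm) {c : ℤ}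
    (hc : pair ν i = D.m i * c) :
    opT D hg i * opX ν = opX (refl i ν) * opT D hg i +
      ((k i : ℂ) - (k i : ℂ)⁻¹) • LinearMap.mulLeft ℂ (geomQuot (D.rootM i) c * mon ν) := by
  refine mon_hom_ext fun μ => ?_
  have hm : (D.m i : ℤ) ≠ 0 := by have := D.m_pos i; omega
  have e : -(c • D.rootM i) + ν = refl i ν := by rw [refl_eq_sub_rootM D hc]; abel
  rw [LinearMap.add_apply, Module.End.mul_apply, Module.End.mul_apply, opX_mon, opT_mon, opT_mon,
    nablaBar_mon, nablaBar_mon, pFun_add_mem D hg i μ hν, pair_add, hc,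
    Int.add_comm (D.m i * c), Int.add_mul_ediv_left _ _ hm, geomQuot_add, refl_add,
    LinearMap.smul_apply, LinearMap.mulLeft_apply, opX_apply, ← mon_mul (refl i ν), ← e, ← mon_mul,
    ← mon_mul (-(c • D.rootM i)) ν]
  simp only [mul_add, add_mul, mul_smul_comm, smul_add, mul_assoc, mul_left_comm (mon ν)]
  abel

theorem opT_mul_opX_zero (i : ι) {ν : weightLattice Φ} (hν : ν ∈ D.Pm) (hc : pair ν i = 0) :
    opT D hg i * opX ν = opX ν * opT D hg i := by
  have e : refl i ν = ν := by rw [refl, hc, zero_smul, sub_zero]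
  rw [opT_mul_opX D hg i hν (c := 0) (by rw [hc, mul_zero]), geomQuot_zero, zero_mul, e]
  simp

/-- Given the quadratic relation, the last factor is T_i⁻¹, so this says T_i x^ν T_i = x^{s_i ν}. -/
theorem opT_mul_opX_one (i : ι) {ν : weightLattice Φ} (hν : ν ∈ D.Pm) (hc : pair ν i = D.m i) :
    opT D hg i * opX ν =
      opX (refl i ν) * (opT D hg i - algebraMap ℂ _ ((k i : ℂ) - (k i : ℂ)⁻¹)) := by
  have e : refl i ν = -D.rootM i + ν := by
    rw [refl_eq_sub_rootM D (c := 1) (by rw [hc, mul_one])]; module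
  rw [opT_mul_opX D hg i hν (c := 1) (by rw [hc, mul_one]), geomQuot_one, neg_mul, mon_mul, ← e,
    mul_sub, ← Algebra.commutes, ← Algebra.smul_def]
  refine LinearMap.ext fun v => ?_
  simp only [LinearMap.add_apply, LinearMap.sub_apply, LinearMap.smul_apply,
    LinearMap.mulLeft_apply, opX_apply, Module.End.mul_apply, neg_mul, smul_neg]
  abel

theorem opT_mul_opX_two (i : ι) {ν : weightLattice Φ} (hν : ν ∈ D.Pm)
    (hc : pair ν i = 2 * D.m i) :
    opT D hg i * opX ν =
      opX (refl i ν) * (opT D hg i - algebraMap ℂ _ ((k i : ℂ) - (k i : ℂ)⁻¹)) -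
        ((k i : ℂ) - (k i : ℂ)⁻¹) • opX (ν - D.rootM i) := by
  have e : -((2 : ℤ) • D.rootM i) + ν = refl i ν := by
    rw [refl_eq_sub_rootM D (c := 2) (by rw [hc, mul_comm])]; abel
  have e' : -D.rootM i + ν = ν - D.rootM i := by abel
  rw [opT_mul_opX D hg i hν (c := 2) (by rw [hc, mul_comm]), geomQuot_two, sub_mul, neg_mul,
    mon_mul, mon_mul, e, e', mul_sub, ← Algebra.commutes, ← Algebra.smul_def]
  refine LinearMap.ext fun v => ?_
  simp only [LinearMap.add_apply, LinearMap.sub_apply, LinearMap.smul_apply,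
    LinearMap.mulLeft_apply, opX_apply, Module.End.mul_apply, sub_mul, neg_mul, smul_sub, smul_neg]
  abel

end Operators


/-! ### Weyl invariance of the coefficients and the quadratic relation -/

section Invariance

variable {ι E : Type*} [NormedAddCommGroup E] [InnerProductSpace ℝ E]
variable {Φ : RootPairing ι ℝ E E}

theorem norm_root_reflectionPerm (hΦ : IsEuclidean Φ) (i j : ι) :
    ‖Φ.root (Φ.reflectionPerm i j)‖ = ‖Φ.root j‖ := by
  have hr : ‖Φ.root i‖ ≠ 0 := norm_ne_zero_iff.mpr (Φ.ne_zero i)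
  have h : ‖Φ.root (Φ.reflectionPerm i j)‖ ^ 2 = ‖Φ.root j‖ ^ 2 := by
    rw [Φ.root_reflectionPerm, Φ.reflection_apply, norm_sub_sq_real,
      show Φ.coroot' i (Φ.root j) = Φ.toLinearMap (Φ.root j) (Φ.coroot i) from rfl, hΦ.pairing_eq,
      hΦ.coroot_eq, inner_smul_right, inner_smul_right, norm_smul, mul_pow, Real.norm_eq_abs,
      sq_abs]
    field_simp
    ring
  exact (sq_eq_sq₀ (norm_nonneg _) (norm_nonneg _)).mp h

variable [Φ.IsCrystallographic] (D : Datum Φ)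

theorem norm_rootM (i : ι) : ‖(D.rootM i : E)‖ = D.m i * ‖Φ.root i‖ := by
  have e : (D.rootM i : E) = (D.m i : ℝ) • Φ.root i := by
    rw [Datum.rootM, AddSubgroup.coe_nsmul, Nat.cast_smul_eq_nsmul]; rfl
  rw [e, norm_smul, Real.norm_natCast]

theorem size_reflectionPerm (hΦ : IsEuclidean Φ) (i j : ι) :
    D.size (Φ.reflectionPerm i j) = D.size j := by
  have h : ‖(D.rootM (Φ.reflectionPerm i j) : E)‖ = ‖(D.rootM j : E)‖ := by
    rw [norm_rootM, norm_rootM, D.m_reflectionPerm, norm_root_reflectionPerm hΦ]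
  rw [Datum.size, Datum.size, h]

theorem QRoot_reflectionPerm (i j : ι) : D.QRoot (Φ.reflectionPerm i j) = D.QRoot j := by
  simp only [Datum.QRoot, Datum.rootP_reflectionPerm, D.Q_refl]

theorem BRoot_refl (i j : ι) (μ : weightLattice Φ) :
    D.BRoot (refl i μ) j = D.BRoot μ (Φ.reflectionPerm i j) := by
  rw [D.BRoot_eq, D.BRoot_eq, pair_refl, QRoot_reflectionPerm]

variable {D} {k : ι → ℂˣ} {g : ℤ → RootSize → ℂˣ} (hg : IsRepParam D k g)

theorem pFun_of_dvd (i : ι) (μ : weightLattice Φ) (h : (D.m i : ℤ) ∣ pair μ i) :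
    pFun D hg i (μ : weightLattice Φ ⧸ D.Pm) = k i := by
  have h' : (D.n : ℤ) ∣ -D.BRoot μ i := by
    rw [dvd_neg, D.BRoot_eq, D.n_dvd_iff]; exact h
  rw [pFun_mk, hg.eq_neg_one _ _ h']
  simp

/-- The reflection changes the sign of B(μ, α_i), so the two values of g are g_j and g_{-j} =
g_{n-j}, with product k⁻². -/
theorem pFun_mul_pFun_refl (i : ι) (μ : weightLattice Φ) (h : ¬ (D.m i : ℤ) ∣ pair μ i) :
    pFun D hg i (μ : weightLattice Φ ⧸ D.Pm) *
      pFun D hg i ((refl i μ : weightLattice Φ) : weightLattice Φ ⧸ D.Pm) = 1 := by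
  have h' : ¬ (D.n : ℤ) ∣ -D.BRoot μ i := by
    rw [dvd_neg, D.BRoot_eq, D.n_dvd_iff]; exact h
  have e : D.BRoot (refl i μ) i = -D.BRoot μ i := by
    rw [D.BRoot_eq, D.BRoot_eq, pair_refl_self, mul_neg]
  have e₂ : g (D.n - -D.BRoot μ i) (D.size i) = g (- -D.BRoot μ i) (D.size i) := by
    rw [hg.periodic, hg.periodic (- -D.BRoot μ i), sub_eq_add_neg, Int.add_emod_left]
  have e₃ := congrArg (Units.val) (hg.mul_eq _ i h')
  rw [e₂] at e₃
  push_cast at e₃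
  rw [pFun_mk, pFun_mk, e]
  have hk0 := (k i).ne_zero
  calc _ = (k i : ℂ) ^ 2 * (g (-D.BRoot μ i) (D.size i) * g (- -D.BRoot μ i) (D.size i)) := by ring
    _ = 1 := by rw [e₃]; field_simp

open Classical in
/-- The coefficient with which `T_α` maps `x^μ` to `x^(s_α μ)`, for `0 ≤ (μ, α^∨) ≤ m(α)`. -/
noncomputable def coef (i : ι) (μ : weightLattice Φ) : ℂ :=
  if pair μ i = D.m i then (k i : ℂ)⁻¹ else pFun D hg i (μ : weightLattice Φ ⧸ D.Pm)

/-- All data in the scalar (m, k, Q and the size) are Weyl invariant. Hence the scalars collected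
along a word can be pulled back to the initial weight, where they are indexed by roots. -/
theorem coef_refl (hΦ : IsEuclidean Φ) (hk : ∀ i j : ι, k (Φ.reflectionPerm i j) = k j) (i j : ι)
    (μ : weightLattice Φ) : coef hg j (refl i μ) = coef hg (Φ.reflectionPerm i j) μ := by
  simp only [coef, pair_refl, D.m_reflectionPerm, hk, pFun_mk, BRoot_refl,
    size_reflectionPerm D hΦ]

theorem pFun_ne_zero (i : ι) (μ : weightLattice Φ) :
    pFun D hg i (μ : weightLattice Φ ⧸ D.Pm) ≠ 0 := by
  rw [pFun_mk]
  exact mul_ne_zero (neg_ne_zero.mpr (k i).ne_zero) (Units.ne_zero _)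

theorem opT_mon_of_lt (i : ι) (μ : weightLattice Φ) (h₀ : 0 ≤ pair μ i) (h₁ : pair μ i < D.m i) :
    opT D hg i (mon μ) = pFun D hg i (μ : weightLattice Φ ⧸ D.Pm) • mon (refl i μ) := by
  rw [opT_mon, nablaBar_mon, Int.ediv_eq_zero_of_lt h₀ h₁, geomQuot_zero, zero_mul, smul_zero,
    zero_add]

/-- On the far wall (μ, α^∨) = m(α) one has s_α μ = μ - α^m, so the divided difference contributes
-(k - k⁻¹) to the same monomial. Together with p = k this leaves k⁻¹, which is why closed alcoves
can be used. -/
theorem opT_mon_of_le (i : ι) (μ : weightLattice Φ) (h₀ : 0 ≤ pair μ i) (h₁ : pair μ i ≤ D.m i) :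
    opT D hg i (mon μ) = coef hg i μ • mon (refl i μ) := by
  have hm : (D.m i : ℤ) ≠ 0 := by have := D.m_pos i; omega
  rcases h₁.eq_or_lt with h | h
  · have e : -D.rootM i + μ = refl i μ := by
      rw [refl_eq_sub_rootM D (c := 1) (by rw [h, mul_one])]; module
    rw [coef, if_pos h, opT_mon, nablaBar_mon, pFun_of_dvd hg i μ (by rw [h]), h, Int.ediv_self hm,
      geomQuot_one, neg_mul, mon_mul, e]
    module
  · rw [coef, if_neg h.ne, opT_mon_of_lt hg i μ h₀ h]

/-- The quadratic expression commutes with x^ν by the cross relations, and division with remainder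
by m(α_i) reduces every weight to 0 ≤ (μ, α_i^∨) < m(α_i). There T_i either multiplies x^μ by k or
acts on the span of x^μ and x^{s_i μ} by a triangular formula with p(μ) p(s_i μ) = 1. -/
theorem opT_mul_self (i : ι) {ν : weightLattice Φ} (hν : ν ∈ D.Pm) (hc : pair ν i = D.m i) :
    opT D hg i * opT D hg i = ((k i : ℂ) - (k i : ℂ)⁻¹) • opT D hg i + 1 := by
  set s := (k i : ℂ) - (k i : ℂ)⁻¹ with hs
  set a := opT D hg i with ha
  have hk0 := (k i).ne_zero
  let S : AddSubgroup (weightLattice Φ) :=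
    { carrier := {x | (a * a - s • a - 1) * opX x = opX x * (a * a - s • a - 1)}
      zero_mem' := by simp [opX_zero]
      add_mem' := by
        intro x y hx hy
        simp only [Set.mem_ofPred_eq] at hx hy ⊢
        rw [← opX_mul, ← mul_assoc, hx, mul_assoc, hy, mul_assoc]
      neg_mem' := by
        intro x hx
        simp only [Set.mem_ofPred_eq] at hx ⊢
        calc _ = opX (-x) * opX x * (a * a - s • a - 1) * opX (-x) := by
              rw [opX_neg_mul, one_mul]
          _ = opX (-x) * ((a * a - s • a - 1) * opX x) * opX (-x) := by
              rw [hx, mul_assoc (opX (-x))]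
          _ = _ := by rw [mul_assoc, mul_assoc, opX_mul_neg, mul_one] }
  have hνS : ν ∈ S := by
    have h₁ : a * opX ν = opX (refl i ν) * (a - algebraMap ℂ _ s) :=
      opT_mul_opX_one D hg i hν hc
    have h₂ : a * opX (refl i ν) = opX ν * a + s • opX (refl i ν) := by
      have e : pair (refl i ν) i = D.m i * (-1) := by rw [pair_refl_self, hc]; ring
      have := opT_mul_opX D hg i (D.refl_mem i hν) e
      rwa [geomQuot_neg_one, one_mul, refl_refl] at this
    rw [mul_sub, ← Algebra.commutes, ← Algebra.smul_def] at h₁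
    change (a * a - s • a - 1) * opX ν = opX ν * (a * a - s • a - 1)
    simp only [sub_mul, mul_sub, mul_assoc, h₁, smul_mul_assoc, mul_smul_comm, smul_sub, one_mul,
      mul_one]
    rw [← mul_assoc a (opX (refl i ν)) a, h₂]
    simp only [add_mul, smul_mul_assoc, smul_add, mul_assoc]
    module
  have base : ∀ μ : weightLattice Φ, 0 ≤ pair μ i → pair μ i < D.m i →
      (a * a - s • a - 1) (mon μ) = 0 := by
    intro μ h₀ h₁
    simp only [LinearMap.sub_apply, LinearMap.smul_apply, Module.End.mul_apply,
      Module.End.one_apply]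
    rcases h₀.eq_or_lt with h | h
    · have e : refl i μ = μ := by rw [refl, ← h, zero_smul, sub_zero]
      have h' : a (mon μ) = (k i : ℂ) • mon μ := by
        rw [ha, opT_mon_of_lt hg i μ h₀ h₁, pFun_of_dvd hg i μ (by rw [← h]; exact dvd_zero _), e]
      rw [h', map_smul, h', smul_smul, smul_smul, ← sub_smul, hs]
      have : (k i : ℂ) * k i - ((k i : ℂ) - (k i : ℂ)⁻¹) * k i = 1 := by field_simp; ring
      rw [this, one_smul, sub_self]
    · have hnd : ¬ (D.m i : ℤ) ∣ pair μ i := fun hd => absurd (Int.le_of_dvd h hd) (by omega)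
      -- Floor division: the pairing lies strictly between -m and 0, so the divided difference of
      -- x^{s_i μ} is x^{s_i μ} itself.
      have e : pair (refl i μ) i / (D.m i : ℤ) = -1 := by
        rw [pair_refl_self]
        refine Int.ediv_eq_iff_of_pos (by omega) |>.mpr ⟨by omega, by omega⟩
      have h₂ : a (mon μ) = pFun D hg i (μ : weightLattice Φ ⧸ D.Pm) • mon (refl i μ) :=
        opT_mon_of_lt hg i μ h₀ h₁
      have h₃ : a (mon (refl i μ)) = s • mon (refl i μ) +
          pFun D hg i ((refl i μ : weightLattice Φ) : weightLattice Φ ⧸ D.Pm) • mon μ := by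
        rw [ha, opT_mon, nablaBar_mon, e, geomQuot_neg_one, one_mul, refl_refl]
      rw [h₂, map_smul, h₃, smul_add, smul_smul _ _ (mon μ), pFun_mul_pFun_refl hg i μ hnd]
      module
  suffices h : a * a - s • a - 1 = 0 by
    rw [sub_sub, sub_eq_zero] at h; exact h
  refine mon_hom_ext fun μ => ?_
  have hm : (0 : ℤ) < D.m i := by have := D.m_pos i; omega
  have hd := Int.emod_add_mul_ediv (pair μ i) (D.m i)
  have h₁ := Int.emod_nonneg (pair μ i) hm.ne'
  have h₂ := Int.emod_lt_of_pos (pair μ i) hm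
  set q := pair μ i / (D.m i : ℤ)
  have hp : pair (μ - q • ν) i = pair μ i % D.m i := by
    rw [pair_sub, pair_zsmul, hc]; linarith
  have hq : q • ν ∈ S := S.zsmul_mem hνS q
  have e : mon μ = opX (q • ν) (mon (μ - q • ν)) := by
    rw [opX_mon]; congr 1; abel
  have hq' := LinearMap.congr_fun (show _ = _ from hq) (mon (μ - q • ν))
  rw [e, LinearMap.zero_apply]
  refine hq'.trans ?_
  rw [Module.End.mul_apply, base _ (by rw [hp]; exact h₁) (by rw [hp]; exact h₂), map_zero]

end Invariance

/-! ### Fundamental weights of Φ^m -/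

section FundamentalWeights

variable {ι E : Type*} [Finite ι] [NormedAddCommGroup E] [InnerProductSpace ℝ E]
variable {Φ : RootPairing ι ℝ E E} [Φ.IsCrystallographic]

/-- The weight lattice of `Φ^m` contains the fundamental weights. -/
theorem exists_fundamental_weight [Φ.IsRootSystem] [Φ.IsReduced] (D : Datum Φ) (b : Φ.Base)
    (i : b.support) :
    ∃ ν ∈ D.Pm, pair ν i = D.m i ∧ ∀ j : b.support, j ≠ i → pair ν j = 0 := by
  classical
  let v : E := Φ.toPerfPair.symm ((D.m i : ℝ) • b.toCoweightBasis.coord i)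
  have hv : ∀ j : b.support, Φ.toLinearMap v (Φ.coroot j) = if j = i then (D.m i : ℝ) else 0 := by
    intro j
    have e : Φ.toLinearMap v = (D.m i : ℝ) • b.toCoweightBasis.coord i :=
      Φ.toPerfPair.apply_symm_apply _
    rw [e, LinearMap.smul_apply, Module.Basis.coord_apply, b.toCoweightBasis_repr_coroot,
      Finsupp.single_apply]
    simp
  -- Divisibility at simple coroots spreads to all coroots through simple reflections: the
  -- correction term is m(α_j)(α_j, α_l^∨) or 0, and α_j^m ∈ P^m makes it divisible by m(α_l).
  have key : ∀ j, ∃ z : ℤ, Φ.toLinearMap v (Φ.coroot j) = D.m j * z := by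
    intro j
    refine b.induction_reflect j (p := fun j => ∃ z : ℤ, Φ.toLinearMap v (Φ.coroot j) = D.m j * z)
      ?_ ?_ ?_
    · rintro l ⟨z, hz⟩
      refine ⟨-z, ?_⟩
      rw [D.m_reflectionPerm, Φ.coroot_reflectionPerm, Φ.coreflection_apply_self, map_neg, hz]
      push_cast; ring
    · intro l hl
      by_cases h : (⟨l, hl⟩ : b.support) = i
      · refine ⟨1, ?_⟩
        rw [hv ⟨l, hl⟩, if_pos h, ← h]; simp
      · refine ⟨0, ?_⟩
        rw [hv ⟨l, hl⟩, if_neg h]; simp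
    · rintro l j ⟨z, hz⟩ hj
      obtain ⟨c, hc⟩ := D.rootM_mem j l
      have hc' : (D.m j : ℝ) * Φ.pairing j l = D.m l * c := by
        have : ((pair (D.rootM j) l : ℤ) : ℝ) = ((D.m l * c : ℤ) : ℝ) := by rw [hc]
        rw [pair_rootM] at this
        push_cast at this
        rw [cast_pair] at this
        exact this
      refine ⟨z - (if (⟨j, hj⟩ : b.support) = i then c else 0), ?_⟩
      rw [D.m_reflectionPerm, Φ.coroot_reflectionPerm, Φ.coreflection_apply, map_sub, map_smul, hz,
        hv ⟨j, hj⟩]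
      split_ifs with h
      · rw [← h, smul_eq_mul, RootPairing.root_coroot_eq_pairing, mul_comm (Φ.pairing j l), hc']
        push_cast; ring
      · simp
  have hvP : v ∈ weightLattice Φ := fun j => by
    obtain ⟨z, hz⟩ := key j
    exact ⟨D.m j * z, by rw [hz]; push_cast; rfl⟩
  refine ⟨⟨v, hvP⟩, fun j => ?_, ?_, fun j hj => ?_⟩
  · obtain ⟨z, hz⟩ := key j
    refine ⟨z, ?_⟩
    have : (pair (⟨v, hvP⟩ : weightLattice Φ) j : ℝ) = D.m j * z := (cast_pair _ _).trans hz
    exact_mod_cast this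
  · have := (cast_pair (⟨v, hvP⟩ : weightLattice Φ) i).trans (hv i)
    rw [if_pos rfl] at this
    exact_mod_cast this
  · have := (cast_pair (⟨v, hvP⟩ : weightLattice Φ) j).trans (hv j)
    rw [if_neg hj] at this
    exact_mod_cast this

end FundamentalWeights


/-! ### Rank two reflections, and the braid relation on the alcove -/

section RankTwo

variable {ι E : Type*} [NormedAddCommGroup E] [InnerProductSpace ℝ E]
variable {Φ : RootPairing ι ℝ E E} [Φ.IsCrystallographic]

theorem rootP_injective : Function.Injective (rootP Φ) := fun _ _ h =>
  Φ.root.injective (congrArg Subtype.val h)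

section Reflections

variable {i j : ι} {a b : ℤ} (hij : pair (rootP Φ i) j = -a) (hji : pair (rootP Φ j) i = -b)

include hji in
-- Tracks a weight by its coordinates relative to a fixed `x`, so composites of reflections become
-- arithmetic in (s, t).
theorem refl_sub_left (x : weightLattice Φ) (s t : ℤ) :
    refl i (x - s • rootP Φ i - t • rootP Φ j) =
      x - (pair x i - s + b * t) • rootP Φ i - t • rootP Φ j := by
  rw [refl, pair_sub, pair_sub, pair_zsmul, pair_zsmul, pair_root_self, hji]
  module

include hij in
theorem refl_sub_right (x : weightLattice Φ) (s t : ℤ) :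
    refl j (x - s • rootP Φ i - t • rootP Φ j) =
      x - s • rootP Φ i - (pair x j - t + a * s) • rootP Φ j := by
  rw [refl, pair_sub, pair_sub, pair_zsmul, pair_zsmul, pair_root_self, hij]
  module

include hij hji

theorem refl_braid_three (h : a = 1 ∧ b = 1) (x : weightLattice Φ) :
    refl i (refl j (refl i x)) = refl j (refl i (refl j x)) := by
  have e : x = x - (0 : ℤ) • rootP Φ i - (0 : ℤ) • rootP Φ j := by module
  rw [e]
  simp only [refl_sub_left hji, refl_sub_right hij]
  rcases h with ⟨rfl, rfl⟩
  module

theorem refl_braid_four (h : a = 1 ∧ b = 2 ∨ a = 2 ∧ b = 1) (x : weightLattice Φ) :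
    refl i (refl j (refl i (refl j x))) = refl j (refl i (refl j (refl i x))) := by
  have e : x = x - (0 : ℤ) • rootP Φ i - (0 : ℤ) • rootP Φ j := by module
  rw [e]
  simp only [refl_sub_left hji, refl_sub_right hij]
  rcases h with ⟨rfl, rfl⟩ | ⟨rfl, rfl⟩ <;> module

theorem refl_braid_six (h : a = 1 ∧ b = 3 ∨ a = 3 ∧ b = 1) (x : weightLattice Φ) :
    refl i (refl j (refl i (refl j (refl i (refl j x))))) =
      refl j (refl i (refl j (refl i (refl j (refl i x))))) := by
  have e : x = x - (0 : ℤ) • rootP Φ i - (0 : ℤ) • rootP Φ j := by module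
  rw [e]
  simp only [refl_sub_left hji, refl_sub_right hij]
  rcases h with ⟨rfl, rfl⟩ | ⟨rfl, rfl⟩ <;> module

/-- The two reduced words of the longest element list the same positive roots in opposite orders;
these are the coincidences needed to match them. The next two lemmas do the same for B₂ and G₂. -/
theorem reflectionPerm_three (h : a = 1 ∧ b = 1) :
    Φ.reflectionPerm i j = Φ.reflectionPerm j i ∧
      Φ.reflectionPerm i (Φ.reflectionPerm j i) = j := by
  rcases h with ⟨rfl, rfl⟩
  constructor <;> apply rootP_injective (Φ := Φ) <;>
    simp only [Datum.rootP_reflectionPerm, refl, pair_sub, pair_zsmul, pair_root_self, hij, hji] <;>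
    module

theorem reflectionPerm_four (h : a = 1 ∧ b = 2 ∨ a = 2 ∧ b = 1) :
    Φ.reflectionPerm i (Φ.reflectionPerm j i) = Φ.reflectionPerm j i ∧
      Φ.reflectionPerm i (Φ.reflectionPerm j (Φ.reflectionPerm i j)) = j := by
  rcases h with ⟨rfl, rfl⟩ | ⟨rfl, rfl⟩ <;>
  constructor <;> apply rootP_injective (Φ := Φ) <;>
    simp only [Datum.rootP_reflectionPerm, refl, pair_sub, pair_zsmul, pair_root_self, hij, hji] <;>
    module

theorem reflectionPerm_six (h : a = 1 ∧ b = 3 ∨ a = 3 ∧ b = 1) :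
    Φ.reflectionPerm i (Φ.reflectionPerm j (Φ.reflectionPerm i j)) =
        Φ.reflectionPerm j (Φ.reflectionPerm i j) ∧
      Φ.reflectionPerm i (Φ.reflectionPerm j (Φ.reflectionPerm i (Φ.reflectionPerm j i))) =
        Φ.reflectionPerm j i ∧
      Φ.reflectionPerm i (Φ.reflectionPerm j (Φ.reflectionPerm i (Φ.reflectionPerm j
        (Φ.reflectionPerm i j)))) = j := by
  rcases h with ⟨rfl, rfl⟩ | ⟨rfl, rfl⟩ <;>
  refine ⟨?_, ?_, ?_⟩ <;> apply rootP_injective (Φ := Φ) <;>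
    simp only [Datum.rootP_reflectionPerm, refl, pair_sub, pair_zsmul, pair_root_self, hij, hji] <;>
    module

end Reflections

section Alcove

variable {D : Datum Φ} {k : ι → ℂˣ} {g : ℤ → RootSize → ℂˣ} (hg : IsRepParam D k g)
variable (hΦ : IsEuclidean Φ) (hk : ∀ i j : ι, k (Φ.reflectionPerm i j) = k j)
variable {i j : ι} {a b : ℤ} (hij : pair (rootP Φ i) j = -a) (hji : pair (rootP Φ j) i = -b)
variable (hm : (D.m j : ℤ) = a * D.m i)

include hΦ hk hij hji hm

/-- Divided by m(α_j), the inequalities bound the simple coroots of Φ^m below by 0 and the highest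
coroot above by 1. So every weight met along either word satisfies the bounds of `opT_mon_of_le`,
and both words multiply the same scalars. The next two lemmas use the same argument with the highest
coroots of B₂ and G₂. -/
theorem opT_braid_three_mon (h : a = 1 ∧ b = 1) {x : weightLattice Φ} (hi : 0 ≤ a * pair x i)
    (hj : 0 ≤ pair x j) (hx : a * pair x i + pair x j ≤ D.m j) :
    (altProd (opT D hg i) (opT D hg j) 3 - altProd (opT D hg j) (opT D hg i) 3) (mon x) = 0 := by
  have hp := pair_refl_eq (Φ := Φ)
  have i₁ := opT_mon_of_le hg i x (by rcases h with ⟨rfl, rfl⟩; omega)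
    (by rcases h with ⟨rfl, rfl⟩; omega)
  have i₂ := opT_mon_of_le hg j (refl i x)
    (by simp only [hp, hij]; rcases h with ⟨rfl, rfl⟩; omega)
    (by simp only [hp, hij]; rcases h with ⟨rfl, rfl⟩; omega)
  have i₃ := opT_mon_of_le hg i (refl j (refl i x))
    (by simp only [hp, hij, hji, pair_root_self]; rcases h with ⟨rfl, rfl⟩; omega)
    (by simp only [hp, hij, hji, pair_root_self]; rcases h with ⟨rfl, rfl⟩; omega)
  have j₁ := opT_mon_of_le hg j x (by rcases h with ⟨rfl, rfl⟩; omega)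
    (by rcases h with ⟨rfl, rfl⟩; omega)
  have j₂ := opT_mon_of_le hg i (refl j x)
    (by simp only [hp, hji]; rcases h with ⟨rfl, rfl⟩; omega)
    (by simp only [hp, hji]; rcases h with ⟨rfl, rfl⟩; omega)
  have j₃ := opT_mon_of_le hg j (refl i (refl j x))
    (by simp only [hp, hij, hji, pair_root_self]; rcases h with ⟨rfl, rfl⟩; omega)
    (by simp only [hp, hij, hji, pair_root_self]; rcases h with ⟨rfl, rfl⟩; omega)
  obtain ⟨p₁, p₂⟩ := reflectionPerm_three hij hji h
  obtain ⟨-, q₂⟩ := reflectionPerm_three hji hij (by omega)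
  simp only [altProd, mul_one, LinearMap.sub_apply, Module.End.mul_apply, i₁, i₂, i₃, j₁, j₂, j₃,
    map_smul, coef_refl hg hΦ hk, p₂, q₂, refl_braid_three hij hji h, smul_smul]
  rw [p₁]
  module

theorem opT_braid_four_mon (h : a = 1 ∧ b = 2 ∨ a = 2 ∧ b = 1) {x : weightLattice Φ}
    (hi : 0 ≤ a * pair x i) (hj : 0 ≤ pair x j) (hx : a * pair x i + 2 * pair x j ≤ D.m j) :
    (altProd (opT D hg i) (opT D hg j) 4 - altProd (opT D hg j) (opT D hg i) 4) (mon x) = 0 := by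
  have key : ∀ (y : weightLattice Φ) (l : ι),
      (0 ≤ pair y l ∧ pair y l ≤ D.m l) →
        opT D hg l (mon y) = coef hg l y • mon (refl l y) :=
    fun y l hyl => opT_mon_of_le hg l y hyl.1 hyl.2
  have hp := pair_refl_eq (Φ := Φ)
  have i₁ := key x i (by rcases h with ⟨rfl, rfl⟩ | ⟨rfl, rfl⟩ <;> omega)
  have i₂ := key (refl i x) j (by
    simp only [hp, hij]; rcases h with ⟨rfl, rfl⟩ | ⟨rfl, rfl⟩ <;> omega)
  have i₃ := key (refl j (refl i x)) i (by
    simp only [hp, hij, hji, pair_root_self]; rcases h with ⟨rfl, rfl⟩ | ⟨rfl, rfl⟩ <;> omega)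
  have i₄ := key (refl i (refl j (refl i x))) j (by
    simp only [hp, hij, hji, pair_root_self]; rcases h with ⟨rfl, rfl⟩ | ⟨rfl, rfl⟩ <;> omega)
  have j₁ := key x j (by rcases h with ⟨rfl, rfl⟩ | ⟨rfl, rfl⟩ <;> omega)
  have j₂ := key (refl j x) i (by
    simp only [hp, hji]; rcases h with ⟨rfl, rfl⟩ | ⟨rfl, rfl⟩ <;> omega)
  have j₃ := key (refl i (refl j x)) j (by
    simp only [hp, hij, hji, pair_root_self]; rcases h with ⟨rfl, rfl⟩ | ⟨rfl, rfl⟩ <;> omega)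
  have j₄ := key (refl j (refl i (refl j x))) i (by
    simp only [hp, hij, hji, pair_root_self]; rcases h with ⟨rfl, rfl⟩ | ⟨rfl, rfl⟩ <;> omega)
  obtain ⟨p₁, p₂⟩ := reflectionPerm_four hij hji h
  obtain ⟨q₁, q₂⟩ := reflectionPerm_four hji hij (by omega)
  simp only [altProd, mul_one, LinearMap.sub_apply, Module.End.mul_apply, i₁, i₂, i₃, i₄, j₁, j₂,
    j₃, j₄, map_smul, coef_refl hg hΦ hk, refl_braid_four hij hji h, smul_smul]
  rw [p₂, q₂, p₁, q₁]
  module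

theorem opT_braid_six_mon (h : a = 1 ∧ b = 3 ∨ a = 3 ∧ b = 1) {x : weightLattice Φ}
    (hi : 0 ≤ a * pair x i) (hj : 0 ≤ pair x j) (hx : 2 * (a * pair x i) + 3 * pair x j ≤ D.m j) :
    (altProd (opT D hg i) (opT D hg j) 6 - altProd (opT D hg j) (opT D hg i) 6) (mon x) = 0 := by
  have key : ∀ (y : weightLattice Φ) (l : ι),
      (0 ≤ pair y l ∧ pair y l ≤ D.m l) →
        opT D hg l (mon y) = coef hg l y • mon (refl l y) :=
    fun y l hyl => opT_mon_of_le hg l y hyl.1 hyl.2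
  have hp := pair_refl_eq (Φ := Φ)
  have i₁ := key x i (by rcases h with ⟨rfl, rfl⟩ | ⟨rfl, rfl⟩ <;> omega)
  have i₂ := key (refl i x) j (by
    simp only [hp, hij]; rcases h with ⟨rfl, rfl⟩ | ⟨rfl, rfl⟩ <;> omega)
  have i₃ := key (refl j (refl i x)) i (by
    simp only [hp, hij, hji, pair_root_self]; rcases h with ⟨rfl, rfl⟩ | ⟨rfl, rfl⟩ <;> omega)
  have i₄ := key (refl i (refl j (refl i x))) j (by
    simp only [hp, hij, hji, pair_root_self]; rcases h with ⟨rfl, rfl⟩ | ⟨rfl, rfl⟩ <;> omega)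
  have i₅ := key (refl j (refl i (refl j (refl i x)))) i (by
    simp only [hp, hij, hji, pair_root_self]; rcases h with ⟨rfl, rfl⟩ | ⟨rfl, rfl⟩ <;> omega)
  have i₆ := key (refl i (refl j (refl i (refl j (refl i x))))) j (by
    simp only [hp, hij, hji, pair_root_self]; rcases h with ⟨rfl, rfl⟩ | ⟨rfl, rfl⟩ <;> omega)
  have j₁ := key x j (by rcases h with ⟨rfl, rfl⟩ | ⟨rfl, rfl⟩ <;> omega)
  have j₂ := key (refl j x) i (by
    simp only [hp, hji]; rcases h with ⟨rfl, rfl⟩ | ⟨rfl, rfl⟩ <;> omega)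
  have j₃ := key (refl i (refl j x)) j (by
    simp only [hp, hij, hji, pair_root_self]; rcases h with ⟨rfl, rfl⟩ | ⟨rfl, rfl⟩ <;> omega)
  have j₄ := key (refl j (refl i (refl j x))) i (by
    simp only [hp, hij, hji, pair_root_self]; rcases h with ⟨rfl, rfl⟩ | ⟨rfl, rfl⟩ <;> omega)
  have j₅ := key (refl i (refl j (refl i (refl j x)))) j (by
    simp only [hp, hij, hji, pair_root_self]; rcases h with ⟨rfl, rfl⟩ | ⟨rfl, rfl⟩ <;> omega)
  have j₆ := key (refl j (refl i (refl j (refl i (refl j x))))) i (by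
    simp only [hp, hij, hji, pair_root_self]; rcases h with ⟨rfl, rfl⟩ | ⟨rfl, rfl⟩ <;> omega)
  obtain ⟨p₁, p₂, p₃⟩ := reflectionPerm_six hij hji h
  obtain ⟨q₁, q₂, q₃⟩ := reflectionPerm_six hji hij (by omega)
  simp only [altProd, mul_one, LinearMap.sub_apply, Module.End.mul_apply, i₁, i₂, i₃, i₄, i₅, i₆,
    j₁, j₂, j₃, j₄, j₅, j₆, map_smul, coef_refl hg hΦ hk, smul_smul]
  rw [p₃, q₃, p₂, q₂, p₁, q₁, refl_braid_six hij hji h]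
  module

end Alcove

end RankTwo


/-! ### From the alcove to all of ℂ[P]: the braid relations -/

section Braid

variable {ι E : Type*} [NormedAddCommGroup E] [InnerProductSpace ℝ E]
variable {Φ : RootPairing ι ℝ E E}

/-- The weights `ν` for which `x^ν` and `x^(-ν)` preserve a subspace of `ℂ[P]`. -/
def shiftStable (K : Submodule ℂ (AddMonoidAlgebra ℂ (weightLattice Φ))) :
    AddSubgroup (weightLattice Φ) where
  carrier := {ν | ∀ v ∈ K, opX ν v ∈ K ∧ opX (-ν) v ∈ K}
  zero_mem' v hv := by simpa [opX_zero] using hv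
  add_mem' {x y} hx hy v hv := by
    constructor
    · rw [← opX_mul]; exact (hx _ (hy v hv).1).1
    · rw [neg_add, ← opX_mul]; exact (hx _ (hy v hv).2).2
  neg_mem' {x} hx v hv := by rw [neg_neg]; exact (hx v hv).symm

theorem mon_mul_mem {K : Submodule ℂ (AddMonoidAlgebra ℂ (weightLattice Φ))}
    {ν : weightLattice Φ} (hν : ν ∈ shiftStable K) {v : AddMonoidAlgebra ℂ (weightLattice Φ)}
    (hv : v ∈ K) : mon ν * v ∈ K := (hν v hv).1

theorem geomQuot_mul_mem {K : Submodule ℂ (AddMonoidAlgebra ℂ (weightLattice Φ))}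
    {β : weightLattice Φ} (hβ : β ∈ shiftStable K) (N : ℤ)
    {v : AddMonoidAlgebra ℂ (weightLattice Φ)} (hv : v ∈ K) : geomQuot β N * v ∈ K := by
  rw [geomQuot, sub_mul, Finset.sum_mul, Finset.sum_mul]
  refine K.sub_mem (K.sum_mem fun l _ => ?_) (K.sum_mem fun l _ => ?_)
  · exact mon_mul_mem (AddSubgroup.nsmul_mem _ hβ l) hv
  · exact mon_mul_mem (neg_mem (AddSubgroup.nsmul_mem _ hβ _)) hv

theorem mem_shiftStable_ker {Δ : Module.End ℂ (AddMonoidAlgebra ℂ (weightLattice Φ))}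
    {ν ν' : weightLattice Φ} (h : Δ * opX ν = opX ν' * Δ) :
    ν ∈ shiftStable (LinearMap.ker Δ) := by
  have h' : Δ * opX (-ν) = opX (-ν') * Δ := by
    calc Δ * opX (-ν) = opX (-ν') * (opX ν' * Δ) * opX (-ν) := by
          rw [← mul_assoc, opX_neg_mul, one_mul]
      _ = _ := by rw [← h, mul_assoc, mul_assoc, opX_mul_neg, mul_one]
  intro v hv
  rw [LinearMap.mem_ker] at hv
  constructor
  · rw [LinearMap.mem_ker, ← Module.End.mul_apply, h, Module.End.mul_apply, hv, map_zero]
  · rw [LinearMap.mem_ker, ← Module.End.mul_apply, h', Module.End.mul_apply, hv, map_zero]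

theorem eq_of_ker_sub_eq_top {A B : Module.End ℂ (AddMonoidAlgebra ℂ (weightLattice Φ))}
    (h : LinearMap.ker (A - B) = ⊤) : A = B :=
  sub_eq_zero.mp (LinearMap.ker_eq_top.mp h)

theorem ker_stable {A T T' : Module.End ℂ (AddMonoidAlgebra ℂ (weightLattice Φ))} {s : ℂ}
    (h : A * T = s • A - T' * A) : ∀ v ∈ LinearMap.ker A, T v ∈ LinearMap.ker A := by
  intro v hv
  rw [LinearMap.mem_ker] at hv ⊢
  rw [← Module.End.mul_apply, h, LinearMap.sub_apply, LinearMap.smul_apply, Module.End.mul_apply,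
    hv, map_zero, smul_zero, sub_zero]

theorem eq_top_of_mon_mem {K : Submodule ℂ (AddMonoidAlgebra ℂ (weightLattice Φ))}
    (h : ∀ x, mon x ∈ K) : K = ⊤ := by
  rw [← K.ker_mkQ]
  exact LinearMap.ker_eq_top.mpr (mon_hom_ext fun x => by
    rw [Submodule.mkQ_apply, LinearMap.zero_apply, Submodule.Quotient.mk_eq_zero]
    exact h x)

variable [Φ.IsCrystallographic]
variable {D : Datum Φ} {k : ι → ℂˣ} {g : ℤ → RootSize → ℂˣ} (hg : IsRepParam D k g)

/-- Both x^{s_i ν} = T_i x^ν T_i and its inverse are composites of operators that preserve `K`. -/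
theorem refl_mem_shiftStable {i : ι}
    {K : Submodule ℂ (AddMonoidAlgebra ℂ (weightLattice Φ))} (hK : ∀ v ∈ K, opT D hg i v ∈ K)
    {ν : weightLattice Φ} (hν : ν ∈ D.Pm) (hp : pair ν i = D.m i) (hs : ν ∈ shiftStable K) :
    refl i ν ∈ shiftStable K := by
  have hq := opT_mul_self hg i hν hp
  have h₁ := opT_mul_opX_one D hg i hν hp
  have hp' : pair (-refl i ν) i = D.m i := by rw [pair_neg, pair_refl_self, hp, neg_neg]
  have h₂ := opT_mul_opX_one D hg i (neg_mem (D.refl_mem i hν)) hp'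
  have e : refl i (-refl i ν) = -ν := by
    rw [refl, pair_neg, pair_refl_self, refl]; module
  rw [e] at h₂
  set a := opT D hg i
  set s := (k i : ℂ) - (k i : ℂ)⁻¹
  have hK' : ∀ v ∈ K, (a - algebraMap ℂ _ s) v ∈ K := fun v hv => by
    rw [LinearMap.sub_apply, Module.algebraMap_end_apply]
    exact K.sub_mem (hK v hv) (K.smul_mem s hv)
  have u₁ : (a - algebraMap ℂ _ s) * a = 1 := by
    rw [sub_mul, hq, ← Algebra.smul_def]; abel
  have f₁ : opX (refl i ν) = a * opX ν * a := by rw [h₁, mul_assoc, u₁, mul_one]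
  have f₂ : opX (-refl i ν) =
      (a - algebraMap ℂ _ s) * opX (-ν) * (a - algebraMap ℂ _ s) := by
    rw [mul_assoc, ← h₂, ← mul_assoc, u₁, one_mul]
  intro v hv
  rw [f₁, f₂]
  simp only [Module.End.mul_apply]
  exact ⟨hK _ (hs _ (hK v hv)).1, hK' _ (hs _ (hK' v hv)).2⟩

/-- T_i maps x^{s_i μ} to a combination of its translates by multiples of α_i^m, which stay in `K`,
plus a nonzero multiple of x^μ. -/
theorem mon_refl_mem {i : ι} {K : Submodule ℂ (AddMonoidAlgebra ℂ (weightLattice Φ))}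
    (hK : ∀ v ∈ K, opT D hg i v ∈ K) (hs : D.rootM i ∈ shiftStable K) {μ : weightLattice Φ}
    (hμ : mon (refl i μ) ∈ K) : mon μ ∈ K := by
  have h := hK _ hμ
  rw [opT_mon, nablaBar_mon, refl_refl] at h
  have h' := (K.add_mem_iff_right (K.smul_mem _ (geomQuot_mul_mem hs _ hμ))).mp h
  exact (K.smul_mem_iff (pFun_ne_zero hg i _)).mp h'

/-- A subspace of `ℂ[P]` that is stable under the operators of a rank two affine Hecke algebra and
contains the monomials in the fundamental alcove is everything. -/
theorem eq_top_of_alcove {i j : ι} {a b : ℤ} (hij : pair (rootP Φ i) j = -a)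
    (hji : pair (rootP Φ j) i = -b) (hm : (D.m j : ℤ) = a * D.m i)
    {K : Submodule ℂ (AddMonoidAlgebra ℂ (weightLattice Φ))}
    (hKi : ∀ v ∈ K, opT D hg i v ∈ K) (hKj : ∀ v ∈ K, opT D hg j v ∈ K)
    {ν : weightLattice Φ} (hν : ν ∈ D.Pm) (hνi : pair ν i = D.m i) (hνj : pair ν j = 0)
    (hs : ν ∈ shiftStable K)
    (h : a * b = 1 ∧ (∀ x, 0 ≤ a * pair x i → 0 ≤ pair x j →
          a * pair x i + pair x j ≤ D.m j → mon x ∈ K) ∨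
      a * b = 2 ∧ (∀ x, 0 ≤ a * pair x i → 0 ≤ pair x j →
          a * pair x i + 2 * pair x j ≤ D.m j → mon x ∈ K) ∨
      a * b = 3 ∧ (∀ x, 0 ≤ a * pair x i → 0 ≤ pair x j →
          2 * (a * pair x i) + 3 * pair x j ≤ D.m j → mon x ∈ K)) : K = ⊤ := by
  have hν₁ : pair (refl i ν) j = D.m j := by rw [pair_refl_eq, hνi, hνj, hij, hm]; ring
  have s₁ := refl_mem_shiftStable hg hKi hν hνi hs
  have s₂ := refl_mem_shiftStable hg hKj (D.refl_mem i hν) hν₁ s₁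
  have e₁ : D.rootM i = ν - refl i ν := by
    rw [refl_eq_sub_rootM D (c := 1) (by rw [hνi, mul_one])]; module
  have e₂ : D.rootM j = refl i ν - refl j (refl i ν) := by
    rw [refl_eq_sub_rootM D (i := j) (c := 1) (by rw [hν₁, mul_one])]; module
  have t₁ : D.rootM i ∈ shiftStable K := by rw [e₁]; exact sub_mem hs s₁
  have t₂ : D.rootM j ∈ shiftStable K := by rw [e₂]; exact sub_mem s₁ s₂
  have shift : ∀ {x y : weightLattice Φ}, y ∈ shiftStable K → mon (x + y) ∈ K → mon x ∈ K := by
    intro x y hy hxy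
    have := mon_mul_mem (neg_mem hy) hxy
    rwa [mon_mul, neg_add_cancel_comm_assoc] at this
  have hL : (0 : ℤ) < D.m j := by have := D.m_pos j; omega
  have key : ∀ U V : ℤ, ∀ x : weightLattice Φ, a * pair x i = U → pair x j = V → mon x ∈ K := by
    -- With U = a(x, α_i^∨) and V = (x, α_j^∨), both coordinates are measured in units of m(α_j),
    -- and the off-diagonal Cartan entries become those of Φ^m, namely -1 and -ab.
    refine alcove_descent (c := a * b) hL ?_ ?_ ?_ ?_ ?_
    · intro U V H x hU hV
      refine mon_refl_mem hg hKi t₁ (H _ ?_ ?_)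
      · rw [pair_refl_self, ← hU]; ring
      · rw [pair_refl_eq, hij, ← hU, ← hV]; ring
    · intro U V H x hU hV
      refine mon_refl_mem hg hKj t₂ (H _ ?_ ?_)
      · rw [pair_refl_eq, hji, ← hU, ← hV]; ring
      · rw [pair_refl_self, ← hV]
    · intro U V H x hU hV
      refine shift hs (H _ ?_ ?_)
      · rw [pair_add, hνi, ← hU, hm]; ring
      · rw [pair_add, hνj, ← hV]; ring
    · intro U V H x hU hV
      -- The weight ν + s_i ν is orthogonal to α_i and pairs to m(α_j) with α_j^∨.
      refine shift (add_mem hs s₁) (H _ ?_ ?_)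
      · rw [pair_add, pair_add, pair_refl_self, ← hU]; ring
      · rw [pair_add, pair_add, hνj, hν₁, ← hV]; ring
    · rcases h with ⟨hc, h⟩ | ⟨hc, h⟩ | ⟨hc, h⟩
      · exact Or.inl ⟨hc, fun U V h₁ h₂ h₃ x hU hV => h x (hU ▸ h₁) (hV ▸ h₂) (by rw [hU, hV]; exact h₃)⟩
      · exact Or.inr (Or.inl ⟨hc, fun U V h₁ h₂ h₃ x hU hV =>
          h x (hU ▸ h₁) (hV ▸ h₂) (by rw [hU, hV]; exact h₃)⟩)
      · exact Or.inr (Or.inr ⟨hc, fun U V h₁ h₂ h₃ x hU hV =>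
          h x (hU ▸ h₁) (hV ▸ h₂) (by rw [hU, hV]; exact h₃)⟩)
  exact eq_top_of_mon_mem fun x => key _ _ x rfl rfl

/-- The braid relation for orthogonal roots. -/
theorem opT_braid_two (hΦ : IsEuclidean Φ) (hk : ∀ i j : ι, k (Φ.reflectionPerm i j) = k j)
    {i j : ι} {ν ν' : weightLattice Φ} (hν : ν ∈ D.Pm) (hνi : pair ν i = D.m i)
    (hνj : pair ν j = 0) (hν' : ν' ∈ D.Pm) (hνi' : pair ν' i = 0) (hνj' : pair ν' j = D.m j)
    (hij : pair (rootP Φ i) j = 0) (hji : pair (rootP Φ j) i = 0) :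
    altProd (opT D hg i) (opT D hg j) 2 = altProd (opT D hg j) (opT D hg i) 2 := by
  apply eq_of_ker_sub_eq_top
  have s₁ := mem_shiftStable_ker (altProd_two_semilinear (opT_mul_opX_one D hg i hν hνi)
    (opT_mul_opX_zero D hg j hν hνj) (opT_mul_opX_zero D hg j (D.refl_mem i hν)
      (by rw [pair_refl_eq, hνj, hij]; ring)))
  have s₂ := mem_shiftStable_ker (altProd_two_semilinear (opT_mul_opX_one D hg j hν' hνj')
    (opT_mul_opX_zero D hg i hν' hνi') (opT_mul_opX_zero D hg i (D.refl_mem j hν')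
      (by rw [pair_refl_eq, hνi', hji]; ring)))
  rw [← neg_sub, LinearMap.ker_neg] at s₂
  refine eq_top_of_mon_mem fun μ => ?_
  have hmi : (0 : ℤ) < D.m i := by have := D.m_pos i; omega
  have hmj : (0 : ℤ) < D.m j := by have := D.m_pos j; omega
  -- Translation by `w` moves μ into the box of remainders modulo m(α_i) and m(α_j), which the two
  -- commuting reflections send to each other's admissible range.
  set w := (pair μ i / (D.m i : ℤ)) • ν + (pair μ j / (D.m j : ℤ)) • ν' with hw
  have xi : pair (μ - w) i = pair μ i % D.m i := by
    rw [hw, pair_sub, pair_add, pair_zsmul, pair_zsmul, hνi, hνi', Int.emod_def]; ring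
  have xj : pair (μ - w) j = pair μ j % D.m j := by
    rw [hw, pair_sub, pair_add, pair_zsmul, pair_zsmul, hνj, hνj', Int.emod_def]; ring
  have yi : pair (refl j (μ - w)) i = pair (μ - w) i := by rw [pair_refl_eq, hji]; ring
  have yj : pair (refl i (μ - w)) j = pair (μ - w) j := by rw [pair_refl_eq, hij]; ring
  have i₀ := xi ▸ Int.emod_nonneg (pair μ i) hmi.ne'
  have i₁ := (xi ▸ Int.emod_lt_of_pos (pair μ i) hmi).le
  have j₀ := xj ▸ Int.emod_nonneg (pair μ j) hmj.ne'
  have j₁ := (xj ▸ Int.emod_lt_of_pos (pair μ j) hmj).le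
  have pij : Φ.reflectionPerm i j = j := by
    apply rootP_injective (Φ := Φ)
    rw [Datum.rootP_reflectionPerm, refl, hji]; module
  have pji : Φ.reflectionPerm j i = i := by
    apply rootP_injective (Φ := Φ)
    rw [Datum.rootP_reflectionPerm, refl, hij]; module
  have hr : refl i (refl j (μ - w)) = refl j (refl i (μ - w)) := by
    rw [refl, yi, refl, refl, yj, refl]; abel
  have hx : mon (μ - w) ∈ LinearMap.ker (altProd (opT D hg i) (opT D hg j) 2 -
      altProd (opT D hg j) (opT D hg i) 2) := by
    simp only [LinearMap.mem_ker, altProd, mul_one, LinearMap.sub_apply, Module.End.mul_apply,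
      opT_mon_of_le hg i _ i₀ i₁, opT_mon_of_le hg j _ j₀ j₁, map_smul,
      opT_mon_of_le hg i _ (yi ▸ i₀) (yi ▸ i₁), opT_mon_of_le hg j _ (yj ▸ j₀) (yj ▸ j₁),
      coef_refl hg hΦ hk, pij, pji, hr, smul_smul]
    module
  have h := mon_mul_mem (add_mem (AddSubgroup.zsmul_mem _ s₁ (pair μ i / (D.m i : ℤ)))
    (AddSubgroup.zsmul_mem _ s₂ (pair μ j / (D.m j : ℤ)))) hx
  rwa [← hw, mon_mul, add_sub_cancel] at h

/-- The braid relation for non-orthogonal simple roots, the root `α_i^m` being short. -/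
theorem opT_braid (hΦ : IsEuclidean Φ) (hk : ∀ i j : ι, k (Φ.reflectionPerm i j) = k j)
    {i j : ι} {ν ν' : weightLattice Φ} (hν : ν ∈ D.Pm) (hνi : pair ν i = D.m i)
    (hνj : pair ν j = 0) (hν' : ν' ∈ D.Pm) (hνj' : pair ν' j = D.m j) {a b : ℤ}
    (hij : pair (rootP Φ i) j = -a) (hji : pair (rootP Φ j) i = -b)
    (hm : (D.m j : ℤ) = a * D.m i) {N : ℕ}
    (h : a = 1 ∧ b = 1 ∧ N = 3 ∨ (a = 1 ∧ b = 2 ∨ a = 2 ∧ b = 1) ∧ N = 4 ∨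
      (a = 1 ∧ b = 3 ∨ a = 3 ∧ b = 1) ∧ N = 6) :
    altProd (opT D hg i) (opT D hg j) N = altProd (opT D hg j) (opT D hg i) N := by
  apply eq_of_ker_sub_eq_top
  have ha := opT_mul_self hg i hν hνi
  have hb := opT_mul_self hg j hν' hνj'
  have m₁ := D.refl_mem i hν
  have m₂ := D.refl_mem j m₁
  have m₃ := D.refl_mem i m₂
  have m₄ := D.refl_mem j m₃
  have m₅ := D.refl_mem i m₄
  have hp := pair_refl_eq (Φ := Φ)
  have r₀ := opT_mul_opX_one D hg i hν hνi
  have r₀' := opT_mul_opX_zero D hg j hν hνj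
  have r₁ := opT_mul_opX_one D hg j m₁ (by rw [hp, hνi, hνj, hij, hm]; ring)
  have swap : ∀ n, (n = 2 ∨ n = 4 ∨ n = 6) →
      ∀ v ∈ LinearMap.ker (altProd (opT D hg i) (opT D hg j) n -
        altProd (opT D hg j) (opT D hg i) n),
      opT D hg j v ∈ LinearMap.ker (altProd (opT D hg i) (opT D hg j) n -
        altProd (opT D hg j) (opT D hg i) n) := by
    intro n hn
    rw [← neg_sub, LinearMap.ker_neg]
    exact ker_stable (altProd_sub_mul_even hb hn)
  rcases h with ⟨rfl, rfl, rfl⟩ | ⟨h, rfl⟩ | ⟨h, rfl⟩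
  -- The two roots are conjugate in type A₂, which supplies the common quadratic parameter needed in
  -- odd length.
  · have hkij : k i = k j := by
      have h₁ := (reflectionPerm_three hij hji ⟨rfl, rfl⟩).2
      rw [← hk j i, ← hk i, h₁]
    rw [← hkij] at hb r₁
    have K₁ := ker_stable (altProd_sub_mul_three ha hb)
    have K₂ := ker_stable (altProd_sub_mul_three hb ha)
    rw [← neg_sub, LinearMap.ker_neg] at K₂
    refine eq_top_of_alcove hg hij hji hm K₁ K₂ hν hνi hνj
      (mem_shiftStable_ker (altProd_three_semilinear ha hb r₀ r₀' r₁
        (opT_mul_opX_zero D hg i m₂ ?_)))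
      (Or.inl ⟨rfl, fun x h₁ h₂ h₃ =>
        opT_braid_three_mon hg hΦ hk hij hji hm ⟨rfl, rfl⟩ h₁ h₂ h₃⟩)
    simp only [hp, hij, hji, hνi, hνj, pair_root_self]; ring
  · have hab : a * b = 2 := by rcases h with ⟨rfl, rfl⟩ | ⟨rfl, rfl⟩ <;> rfl
    refine eq_top_of_alcove hg hij hji hm (ker_stable (altProd_sub_mul_even ha (by simp)))
      (swap 4 (by simp)) hν hνi hνj
      (mem_shiftStable_ker (altProd_four_semilinear ha hb r₀ r₀' r₁
        (opT_mul_opX_one D hg i m₂ ?_) (opT_mul_opX_zero D hg j m₃ ?_)))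
      (Or.inr (Or.inl ⟨hab, fun x h₁ h₂ h₃ =>
        opT_braid_four_mon hg hΦ hk hij hji hm h h₁ h₂ h₃⟩))
    all_goals
      simp only [hp, hij, hji, hνi, hνj, pair_root_self]
      rcases h with ⟨rfl, rfl⟩ | ⟨rfl, rfl⟩ <;> ring
  · have hab : a * b = 3 := by rcases h with ⟨rfl, rfl⟩ | ⟨rfl, rfl⟩ <;> rfl
    -- This is the central weight of the string of length two, orthogonal to α_i and α_j.
    have m₂' : refl j (refl i ν) - D.rootM i ∈ D.Pm := sub_mem m₂ (D.rootM_mem i)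
    refine eq_top_of_alcove hg hij hji hm (ker_stable (altProd_sub_mul_even ha (by simp)))
      (swap 6 (by simp)) hν hνi hνj
      (mem_shiftStable_ker (altProd_six_semilinear ha hb r₀ r₀' r₁
        (opT_mul_opX_two D hg i m₂ ?_) (opT_mul_opX_one D hg j m₃ ?_)
        (opT_mul_opX_one D hg i m₄ ?_) (opT_mul_opX_zero D hg j m₅ ?_)
        (opT_mul_opX_zero D hg i m₂' ?_) (opT_mul_opX_zero D hg j m₂' ?_)))
      (Or.inr (Or.inr ⟨hab, fun x h₁ h₂ h₃ =>
        opT_braid_six_mon hg hΦ hk hij hji hm h h₁ h₂ h₃⟩))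
    all_goals
      simp only [hp, hij, hji, hνi, hνj, pair_root_self, pair_sub, pair_rootM, hm]
      rcases h with ⟨rfl, rfl⟩ | ⟨rfl, rfl⟩ <;> ring

end Braid


/-! ### The order of a product of two simple reflections -/

section Order

variable {ι E : Type*} [NormedAddCommGroup E] [InnerProductSpace ℝ E]
variable {Φ : RootPairing ι ℝ E E} {i j : ι} {a b : ℝ}

theorem reflection_mul_apply (hij : Φ.pairing i j = -a) (hji : Φ.pairing j i = -b) (x : E)
    (s t : ℝ) :
    (Φ.reflection i * Φ.reflection j) (x - s • Φ.root i - t • Φ.root j) =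
      x - (Φ.coroot' i x - s + b * (Φ.coroot' j x - t + a * s)) • Φ.root i -
        (Φ.coroot' j x - t + a * s) • Φ.root j := by
  rw [LinearEquiv.mul_apply, Φ.reflection_apply, Φ.reflection_apply]
  simp only [map_sub, map_smul, RootPairing.root_coroot'_eq_pairing, RootPairing.pairing_same, hij,
    hji, smul_eq_mul]
  module

theorem orderOf_reflection_mul (hij : Φ.pairing i j = -a) (hji : Φ.pairing j i = -b)
    (hli : LinearIndependent ℝ ![Φ.root i, Φ.root j]) {N : ℕ}
    (h : a = 0 ∧ b = 0 ∧ N = 2 ∨ a = 1 ∧ b = 1 ∧ N = 3 ∨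
      (a = 1 ∧ b = 2 ∨ a = 2 ∧ b = 1) ∧ N = 4 ∨ (a = 1 ∧ b = 3 ∨ a = 3 ∧ b = 1) ∧ N = 6) :
    orderOf (Φ.reflection i * Φ.reflection j) = N := by
  have step := reflection_mul_apply hij hji
  have start : ∀ x : E, x = x - (0 : ℝ) • Φ.root i - (0 : ℝ) • Φ.root j := fun x => by module
  have one : ∀ n, (∀ x, ((Φ.reflection i * Φ.reflection j) ^ n)
      (x - (0 : ℝ) • Φ.root i - (0 : ℝ) • Φ.root j) = x) →
      (Φ.reflection i * Φ.reflection j) ^ n = 1 := fun n H => by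
    refine LinearEquiv.ext fun x => ?_
    conv_lhs => rw [start x]
    exact H x
  -- The test vector is α_j, written with coefficients (0, -1); by linear independence a power that
  -- fixes it must return t = -1.
  have ne_one : ∀ n (s t : ℝ), ((Φ.reflection i * Φ.reflection j) ^ n)
      (0 - (0 : ℝ) • Φ.root i - (-1 : ℝ) • Φ.root j) = 0 - s • Φ.root i - t • Φ.root j →
      t ≠ -1 → (Φ.reflection i * Φ.reflection j) ^ n ≠ 1 := by
    intro n s t H ht h1
    rw [h1, LinearEquiv.coe_one, id] at H
    have := LinearIndependent.pair_iff.mp hli s (t + 1) (by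
      rw [← sub_eq_zero] at H
      rw [← H]; module)
    exact ht (by linarith [this.2])
  have h0 : ∀ l, Φ.coroot' l (0 : E) = 0 := fun l => map_zero _
  rcases h with ⟨rfl, rfl, rfl⟩ | ⟨rfl, rfl, rfl⟩ | ⟨h, rfl⟩ | ⟨h, rfl⟩
  · refine orderOf_eq_prime (one 2 fun x => ?_) ?_
    · simp only [pow_succ, pow_zero, one_mul, LinearEquiv.mul_apply (_ * _), step]
      module
    · rw [← pow_one (_ * _)]
      refine ne_one 1 0 1 ?_ (by norm_num)
      rw [pow_one, step, h0, h0]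
      module
  · have : Fact (Nat.Prime 3) := ⟨by norm_num⟩
    refine orderOf_eq_prime (one 3 fun x => ?_) ?_
    · simp only [pow_succ, pow_zero, one_mul, LinearEquiv.mul_apply (_ * _), step]
      module
    · rw [← pow_one (_ * _)]
      refine ne_one 1 1 1 ?_ (by norm_num)
      rw [pow_one, step, h0, h0]
      module
  · have : Fact (Nat.Prime 2) := ⟨by norm_num⟩
    refine orderOf_eq_prime_pow (p := 2) (n := 1) (ne_one 2 0 1 ?_ (by norm_num))
      (one 4 fun x => ?_)
    all_goals
      simp only [pow_succ, pow_zero, one_mul, LinearEquiv.mul_apply (_ * _), step, h0]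
      rcases h with ⟨rfl, rfl⟩ | ⟨rfl, rfl⟩ <;> module
  · refine orderOf_eq_of_pow_and_pow_div_prime (by norm_num) (one 6 fun x => ?_) fun p hp hd => ?_
    · simp only [pow_succ, pow_zero, one_mul, LinearEquiv.mul_apply (_ * _), step]
      rcases h with ⟨rfl, rfl⟩ | ⟨rfl, rfl⟩ <;> module
    · have hp' : p = 2 ∨ p = 3 := by
        have := Nat.le_of_dvd (by norm_num) hd
        interval_cases p <;> revert hp hd <;> norm_num
      rcases hp' with rfl | rfl
      · refine ne_one 3 0 1 ?_ (by norm_num)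
        simp only [pow_succ, pow_zero, one_mul, LinearEquiv.mul_apply (_ * _), step, h0]
        rcases h with ⟨rfl, rfl⟩ | ⟨rfl, rfl⟩ <;> module
      · refine ne_one 2 b 2 ?_ (by norm_num)
        simp only [pow_succ, pow_zero, one_mul, LinearEquiv.mul_apply (_ * _), step, h0]
        rcases h with ⟨rfl, rfl⟩ | ⟨rfl, rfl⟩ <;> module

end Order


/-! ### Verification of all Hecke relations -/

section Main

variable {ι E : Type*} [NormedAddCommGroup E] [InnerProductSpace ℝ E]
variable {Φ : RootPairing ι ℝ E E} [Φ.IsCrystallographic]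
variable {D : Datum Φ} {k : ι → ℂˣ} {g : ℤ → RootSize → ℂˣ} (hg : IsRepParam D k g)

theorem pair_rootP_eq_pairingIn (i j : ι) : pair (rootP Φ i) j = Φ.pairingIn ℤ i j := by
  have h : ((pair (rootP Φ i) j : ℤ) : ℝ) = ((Φ.pairingIn ℤ i j : ℤ) : ℝ) := by
    rw [cast_pair]
    exact (Φ.algebraMap_pairingIn ℤ i j).symm
  exact_mod_cast h

/-- The action of the free algebra on `ℂ[P]`. -/
noncomputable def freeAction (b : Φ.Base) :
    FreeAlgebra ℂ (b.support ⊕ D.Pm) →ₐ[ℂ]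
      Module.End ℂ (AddMonoidAlgebra ℂ (weightLattice Φ)) :=
  FreeAlgebra.lift ℂ (Sum.elim (fun i => opT D hg i) fun ν => opX ν.1)

theorem freeAction_freeT (b : Φ.Base) (i : b.support) :
    freeAction hg b (freeT D b i) = opT D hg i := by
  rw [freeAction, freeT, FreeAlgebra.lift_ι_apply, Sum.elim_inl]

/-- General `f` is needed because the right side of the cross relation is a divided difference, not
a monomial. -/
theorem freeAction_freeX (b : Φ.Base) (f : AddMonoidAlgebra ℂ D.Pm) :
    freeAction hg b (freeX D b f) =
      LinearMap.mulLeft ℂ (AddMonoidAlgebra.mapDomainAlgHom ℂ ℂ D.Pm.subtype f) := by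
  have h : (freeAction hg b).toLinearMap ∘ₗ freeX D b =
      (Algebra.lmul ℂ (AddMonoidAlgebra ℂ (weightLattice Φ))).toLinearMap ∘ₗ
        (AddMonoidAlgebra.mapDomainAlgHom ℂ ℂ D.Pm.subtype).toLinearMap := by
    refine mon_hom_ext fun ν => ?_
    rw [LinearMap.comp_apply, freeX, linExt_mon, AlgHom.toLinearMap_apply, freeAction,
      FreeAlgebra.lift_ι_apply, Sum.elim_inr, LinearMap.comp_apply]
    refine LinearMap.ext fun v => ?_
    simp [opX, mon]
  exact LinearMap.congr_fun h f

theorem freeAction_freeX_mon (b : Φ.Base) (ν : D.Pm) :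
    freeAction hg b (freeX D b (mon ν)) = opX ν.1 := by
  rw [freeX, linExt_mon, freeAction, FreeAlgebra.lift_ι_apply, Sum.elim_inr]

variable [Finite ι] [Φ.IsRootSystem] [Φ.IsReduced]

theorem opT_braid_orderOf (hΦ : IsEuclidean Φ) (hk : ∀ i j : ι, k (Φ.reflectionPerm i j) = k j)
    (b : Φ.Base) (i j : b.support) (hij : i ≠ j) :
    altProd (opT D hg i) (opT D hg j) (orderOf (Φ.reflection i * Φ.reflection j)) =
      altProd (opT D hg j) (opT D hg i) (orderOf (Φ.reflection i * Φ.reflection j)) := by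
  obtain ⟨ν, hν, hνi, hν0⟩ := exists_fundamental_weight D b i
  obtain ⟨ν', hν', hνj', hν0'⟩ := exists_fundamental_weight D b j
  have hνj := hν0 j hij.symm
  have hνi' := hν0' i hij
  have hij' : (i : ι) ≠ j := fun h => hij (Subtype.ext h)
  have hmem := Φ.pairingIn_pairingIn_mem_set_of_isCrystal_of_isRed' (i : ι) (j : ι)
    (fun h => hij' (Φ.root.injective h)) (b.root_ne_neg_of_ne i.2 j.2 hij')
  have hle := b.pairingIn_le_zero_of_ne hij' i.2 j.2
  have hle' := b.pairingIn_le_zero_of_ne hij'.symm j.2 i.2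
  rw [← pair_rootP_eq_pairingIn] at hle hle'
  rw [← pair_rootP_eq_pairingIn, ← pair_rootP_eq_pairingIn] at hmem
  obtain ⟨a, ha⟩ : ∃ a : ℤ, pair (rootP Φ i) j = -a := ⟨_, (neg_neg _).symm⟩
  obtain ⟨c, hc⟩ : ∃ c : ℤ, pair (rootP Φ j) i = -c := ⟨_, (neg_neg _).symm⟩
  have ha' : Φ.pairing i j = -(a : ℝ) := by
    have := cast_pair (rootP Φ (i : ι)) (j : ι)
    rw [ha] at this
    push_cast at this
    exact this.symm
  have hc' : Φ.pairing j i = -(c : ℝ) := by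
    have := cast_pair (rootP Φ (j : ι)) (i : ι)
    rw [hc] at this
    push_cast at this
    exact this.symm
  have hli := b.linearIndependent_pair_of_ne hij
  have hcases : (a = 0 ∧ c = 0) ∨ (a = 1 ∧ c = 1) ∨ (a = 1 ∧ c = 2 ∨ a = 2 ∧ c = 1) ∨
      (a = 1 ∧ c = 3 ∨ a = 3 ∧ c = 1) := by
    rw [ha, hc] at hmem
    simp only [Set.mem_insert_iff, Set.mem_singleton_iff, Prod.mk.injEq] at hmem
    omega
  rcases hcases with ⟨rfl, rfl⟩ | hpos
  · have hN : orderOf (Φ.reflection i * Φ.reflection j) = 2 :=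
      orderOf_reflection_mul ha' hc' hli (Or.inl ⟨by norm_num, by norm_num, rfl⟩)
    rw [hN]
    exact opT_braid_two hg hΦ hk hν hνi hνj hν' hνi' hνj' ha hc
  · obtain ⟨N, hN⟩ : ∃ N : ℕ, a = 1 ∧ c = 1 ∧ N = 3 ∨ (a = 1 ∧ c = 2 ∨ a = 2 ∧ c = 1) ∧ N = 4 ∨
        (a = 1 ∧ c = 3 ∨ a = 3 ∧ c = 1) ∧ N = 6 := by
      rcases hpos with h | h | h
      · exact ⟨3, by omega⟩
      · exact ⟨4, by omega⟩
      · exact ⟨6, by omega⟩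
    have hord : orderOf (Φ.reflection i * Φ.reflection j) = N :=
      orderOf_reflection_mul ha' hc' hli (Or.inr (by exact_mod_cast hN))
    rw [hord]
    -- Here `x` and `y` are the off-diagonal Cartan entries of Φ^m. They are negative with product
    -- ac < 4, so one of them is -1, and this identifies a root that can play the short one in
    -- `opT_braid`.
    obtain ⟨x, hx⟩ := D.rootM_mem i j
    obtain ⟨y, hy⟩ := D.rootM_mem j i
    rw [pair_rootM, ha] at hx
    rw [pair_rootM, hc] at hy
    have hmi : (0 : ℤ) < D.m i := by have := D.m_pos i; omega
    have hmj : (0 : ℤ) < D.m j := by have := D.m_pos j; omega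
    have hac : 0 < a ∧ 0 < c := by omega
    have hxneg : x < 0 := by nlinarith [mul_pos hmi hac.1]
    have hyneg : y < 0 := by nlinarith [mul_pos hmj hac.2]
    have hxy : x * y = a * c := by
      have h : (D.m i * D.m j : ℤ) * (x * y) = (D.m i * D.m j) * (a * c) := by
        linear_combination (-(D.m i : ℤ) * y) * hx + (D.m i * a : ℤ) * hy
      exact mul_left_cancel₀ (mul_pos hmi hmj).ne' h
    have hor : x = -1 ∨ y = -1 := by
      by_contra hcon
      push Not at hcon
      have h1 : x ≤ -2 := by omega
      have h2 : y ≤ -2 := by omega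
      have h3 : a * c < 4 := by
        rcases hpos with ⟨rfl, rfl⟩ | (⟨rfl, rfl⟩ | ⟨rfl, rfl⟩) | (⟨rfl, rfl⟩ | ⟨rfl, rfl⟩) <;>
          norm_num
      nlinarith
    rcases hor with rfl | rfl
    · exact opT_braid hg hΦ hk hν hνi hνj hν' hνj' ha hc (by linarith) hN
    · exact (opT_braid hg hΦ hk hν' hνj' hνi' hν hνi hc ha (by linarith) (by omega)).symm

theorem freeAction_rel (hΦ : IsEuclidean Φ) (hk : ∀ i j : ι, k (Φ.reflectionPerm i j) = k j)
    (b : Φ.Base) ⦃x y : FreeAlgebra ℂ (b.support ⊕ D.Pm)⦄ (h : HeckeRel D b k x y) :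
    freeAction hg b x = freeAction hg b y := by
  have halt : ∀ (p q : FreeAlgebra ℂ (b.support ⊕ D.Pm)) (N : ℕ),
      freeAction hg b (altProd p q N) = altProd (freeAction hg b p) (freeAction hg b q) N := by
    intro p q N
    induction N generalizing p q with
    | zero => exact map_one _
    | succ N ih => rw [altProd, altProd, map_mul, ih]
  cases h with
  | quadratic i =>
    obtain ⟨ν, hν, hνi, -⟩ := exists_fundamental_weight D b i
    have hq := opT_mul_self hg i hν hνi
    have hk0 := (k i).ne_zero
    rw [map_mul, map_sub, map_add, AlgHom.commutes, AlgHom.commutes, freeAction_freeT, map_zero,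
      sub_mul, mul_add, mul_add, hq, ← Algebra.commutes (k i : ℂ)⁻¹, ← map_mul,
      mul_inv_cancel₀ hk0, map_one, ← Algebra.smul_def, ← Algebra.smul_def]
    module
  | braid i j hij =>
    rw [halt, halt, freeAction_freeT, freeAction_freeT]
    exact opT_braid_orderOf hg hΦ hk b i j hij
  | x_zero =>
    rw [freeAction_freeX_mon, map_one]
    exact opX_zero
  | x_add μ ν =>
    rw [map_mul, freeAction_freeX_mon, freeAction_freeX_mon, freeAction_freeX_mon]
    exact opX_mul _ _
  | cross i ν =>
    obtain ⟨c, hc⟩ := ν.2 i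
    have hm : (D.m i : ℤ) ≠ 0 := by have := D.m_pos i; omega
    rw [map_sub, map_mul, map_mul, map_smul, freeAction_freeT, freeAction_freeX_mon,
      freeAction_freeX_mon, freeAction_freeX, Datum.nablaM, linExt_mon, map_mul, map_geomQuot, hc,
      Int.mul_ediv_cancel_left _ hm, opT_mul_opX D hg i ν.2 hc]
    have e : AddMonoidAlgebra.mapDomainAlgHom ℂ ℂ D.Pm.subtype (mon ν) = mon ν.1 := by
      simp [mon]
    rw [e]
    exact add_sub_cancel_left _ _

end Main

end Metaplectic

open Metaplectic in
theorem theorem3 {ι E : Type*} [Finite ι] [NormedAddCommGroup E] [InnerProductSpace ℝ E]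
    (Φ : RootPairing ι ℝ E E) [Φ.IsRootSystem] [Φ.IsCrystallographic] [Φ.IsReduced]
    [Φ.IsIrreducible] (hΦ : Metaplectic.IsEuclidean Φ) (b : Φ.Base)
    (D : Metaplectic.Datum Φ)
    (k : ι → ℂˣ) (hk : ∀ i j : ι, k (Φ.reflectionPerm i j) = k j)
    (g : ℤ → Metaplectic.RootSize → ℂˣ) (hg : Metaplectic.IsRepParam D k g) :
    ∃! π : Metaplectic.AffineHecke D b k →ₐ[ℂ]
        Module.End ℂ (AddMonoidAlgebra ℂ (Metaplectic.weightLattice Φ)),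
      (∀ (i : b.support) (μ : Metaplectic.weightLattice Φ),
        π (Metaplectic.heckeT D b k i) (Metaplectic.mon μ) =
          ((k i : ℂ) - (k i : ℂ)⁻¹) • D.nablaBar i (Metaplectic.mon μ) +
            Metaplectic.pFun D hg i (μ : Metaplectic.weightLattice Φ ⧸ D.Pm) •
              Metaplectic.mon (Metaplectic.refl (i : ι) μ)) ∧
      (∀ (ν : D.Pm) (μ : Metaplectic.weightLattice Φ),
        π (Metaplectic.heckeX D b k ν) (Metaplectic.mon μ) =
          Metaplectic.mon (μ + (ν : Metaplectic.weightLattice Φ))) := by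
  refine ⟨RingQuot.liftAlgHom ℂ ⟨freeAction hg b, freeAction_rel hg hΦ hk b⟩, ⟨?_, ?_⟩, ?_⟩
  · intro i μ
    rw [heckeT, RingQuot.liftAlgHom_mkAlgHom_apply, freeAction_freeT, opT_mon]
  · intro ν μ
    rw [heckeX, RingQuot.liftAlgHom_mkAlgHom_apply, freeAction_freeX_mon, opX_mon, add_comm]
  · rintro π ⟨hT, hX⟩
    -- Uniqueness reduces to the free generators, where the prescribed values on monomials determine
    -- the operators.
    refine RingQuot.liftAlgHom_unique ℂ _ (freeAction_rel hg hΦ hk b) π (FreeAlgebra.hom_ext ?_)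
    funext s
    refine mon_hom_ext fun μ => ?_
    rcases s with i | ν
    · refine (hT i μ).trans ?_
      rw [← opT_mon, ← freeAction_freeT hg b]
      rfl
    · have h := hX ν μ
      rw [heckeX, freeX, linExt_mon] at h
      refine h.trans ?_
      rw [add_comm, ← opX_mon, ← freeAction_freeX_mon hg b, freeX, linExt_mon]
      rfl
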